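/- **Conventions.** A theory $T$ is *finite-dimensional* if there is a function $\dim$ from the interpretable sets of the models of $T$ to $\mathbb{N}\cup\{-\infty\}$ such that, for interpretable sets $X,Y$ and an interpretable function $f\colon X\to Y$: (i) $\dim\varphi(x,a)=\dim\varphi(x,a')$ if $a,a'$ have the same type over $\emptyset$; (ii) $\dim\emptyset=-\infty$, and for $X\neq\emptyset$, $\dim X=0$ if and only if $X$ is finite; (iii) $\dim(X\cup Y)=\max\{\dim X,\dim Y\}$; (iv) if $\dim f^{-1}(y)\ge k$ for all $y\in Y$, then $\dim X\ge\dim Y+k$; (v) if $\dim f^{-1}(y)\le k$ for all $y\in Y$, then $\dim X\le\dim Y+k$. A *definable Lie ring of finite dimension* is a Lie ring definable (with parameters, possibly on imaginary elements, i.e. interpretable) in a model of a finite-dimensional theory; "definable" means definable with parameters in that model. For a Lie ring $\mathfrak g$: the *Radical ideal* $R(\mathfrak g)$ is the sum of all soluble ideals. The *almost centre* $\widetilde Z(\mathfrak g)$ is the ideal of all $x\in\mathfrak g$ whose centraliser $\{y:[x,y]=0\}$ has finite index in $(\mathfrak g,+)$, and $\mathfrak g$ is *almost abelian* if $\widetilde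 Z(\mathfrak g)=\mathfrak g$. The *almost Radical* ideal $\widetilde R(\mathfrak g)$ is the sum of all ideals $\mathfrak h$ that admit a series $\mathfrak h=\mathfrak h_0\ge\mathfrak h_1\ge\dots\ge\mathfrak h_n=\{0\}$ of ideals of $\mathfrak g$ with every $\mathfrak h_i/\mathfrak h_{i+1}$ almost abelian. $\mathfrak g$ is *semi-simple* if it is not abelian and has no nonzero abelian ideal. A definable Lie ring of finite dimension is *absolutely simple* if no definable Lie subring $\mathfrak h$ of finite index in it has an infinite definable ideal of infinite index in $\mathfrak h$; it is *virtually almost abelian* if it has an almost abelian definable Lie subring of finite index. **Theorem.** Let $\mathfrak g$ be a definable Lie ring of finite dimension. Then: 1. $R(\mathfrak g)$ is definable and soluble. 2. $R(\mathfrak g)\le\widetilde R(\mathfrak g)$ and the index of $R(\mathfrak g)$ in $\widetilde R(\mathfrak g)$ is finite; moreover $\widetilde R(\mathfrak g)$ is definable and virtually soluble (it has a soluble Lie subring of finite index). 3. If $\mathfrak g$ is absolutely simple and not virtually almost abelian, then $\mathfrak g/\widetilde Z(\mathfrak g)$ is a definable Lie ring, and it is absolutely simple and semi-simple. -/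

import Mathlib

open FirstOrder

universe u v w z

/-! ### Finite-dimensional theories -/


/-- The definable sets of the structure `M`, with arbitrary parameters from `M`. -/
def DefinableIn (L : FirstOrder.Language.{u, v}) {M : Type w} [L.Structure M] {α : Type*}
    (S : Set (α → M)) : Prop :=
  (Set.univ : Set M).Definable L S

/-- `X ⊆ Mⁿ / E` is an interpretable set of `M`: the equivalence relation `E` on `Mⁿ` is definable
and so is the preimage of `X` in `Mⁿ`. -/
def IsInterpretable (L : FirstOrder.Language.{u, v}) {M : Type w} [L.Structure M] {n : ℕ}
    (E : Setoid (Fin n → M)) (X : Set (Quotient E)) : Prop :=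
  DefinableIn L {p : Fin n ⊕ Fin n → M | E.r (p ∘ Sum.inl) (p ∘ Sum.inr)} ∧
    DefinableIn L (Quotient.mk E ⁻¹' X)

/-- `f` restricts to an interpretable function from `X` to `Y`. Its values outside `X` are
irrelevant. -/
def IsInterpretableMap (L : FirstOrder.Language.{u, v}) {M : Type w} [L.Structure M] {n m : ℕ}
    {E : Setoid (Fin n → M)} {F : Setoid (Fin m → M)} (X : Set (Quotient E)) (Y : Set (Quotient F))
    (f : Quotient E → Quotient F) : Prop :=
  Set.MapsTo f X Y ∧
    DefinableIn L {p : Fin n ⊕ Fin m → M |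
      Quotient.mk E (p ∘ Sum.inl) ∈ X ∧
        f (Quotient.mk E (p ∘ Sum.inl)) = Quotient.mk F (p ∘ Sum.inr)}

/-- A dimension on the interpretable sets of the models of `T`, with values in `ℕ ∪ {-∞}`
(`⊥` is `-∞`). The value of `dim` at a set that is not interpretable is irrelevant: every law is
about interpretable sets only. -/
structure TheoryDimension {L : FirstOrder.Language.{u, v}} (T : L.Theory) where
  dim : ∀ (M : Type w) [L.Structure M] [Nonempty M] [M ⊨ T] {n : ℕ} (E : Setoid (Fin n → M)),
    Set (Quotient E) → WithBot ℕ
  /-- Members of a family of interpretable sets (uniformly given by the formulas `ε` and `φ`) whose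
  parameters have the same type over `∅` have the same dimension. -/
  invariance : ∀ (M : Type w) [L.Structure M] [Nonempty M] [M ⊨ T] {n m : ℕ}
    (ε : L.Formula (Fin n ⊕ (Fin n ⊕ Fin m))) (φ : L.Formula (Fin n ⊕ Fin m)) (a a' : Fin m → M)
    (E E' : Setoid (Fin n → M)) (X : Set (Quotient E)) (X' : Set (Quotient E')),
    (∀ ψ : L.Formula (Fin m), ψ.Realize a ↔ ψ.Realize a') →
    (∀ x y, E.r x y ↔ ε.Realize (Sum.elim x (Sum.elim y a))) →
    (∀ x y, E'.r x y ↔ ε.Realize (Sum.elim x (Sum.elim y a'))) →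
    (∀ x, Quotient.mk E x ∈ X ↔ φ.Realize (Sum.elim x a)) →
    (∀ x, Quotient.mk E' x ∈ X' ↔ φ.Realize (Sum.elim x a')) →
    dim M E X = dim M E' X'
  dim_empty : ∀ (M : Type w) [L.Structure M] [Nonempty M] [M ⊨ T] {n : ℕ}
    (E : Setoid (Fin n → M)), IsInterpretable L E ∅ → dim M E ∅ = ⊥
  dim_eq_zero_iff : ∀ (M : Type w) [L.Structure M] [Nonempty M] [M ⊨ T] {n : ℕ}
    (E : Setoid (Fin n → M)) (X : Set (Quotient E)), IsInterpretable L E X → X.Nonempty →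
    (dim M E X = 0 ↔ X.Finite)
  dim_union : ∀ (M : Type w) [L.Structure M] [Nonempty M] [M ⊨ T] {n : ℕ}
    (E : Setoid (Fin n → M)) (X Y : Set (Quotient E)),
    IsInterpretable L E X → IsInterpretable L E Y →
    dim M E (X ∪ Y) = max (dim M E X) (dim M E Y)
  le_dim_of_fibers : ∀ (M : Type w) [L.Structure M] [Nonempty M] [M ⊨ T] {n m : ℕ}
    (E : Setoid (Fin n → M)) (F : Setoid (Fin m → M)) (X : Set (Quotient E)) (Y : Set (Quotient F))
    (f : Quotient E → Quotient F) (k : ℕ),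
    IsInterpretable L E X → IsInterpretable L F Y → IsInterpretableMap L X Y f →
    (∀ y ∈ Y, (k : WithBot ℕ) ≤ dim M E (X ∩ f ⁻¹' {y})) →
    dim M F Y + (k : WithBot ℕ) ≤ dim M E X
  dim_le_of_fibers : ∀ (M : Type w) [L.Structure M] [Nonempty M] [M ⊨ T] {n m : ℕ}
    (E : Setoid (Fin n → M)) (F : Setoid (Fin m → M)) (X : Set (Quotient E)) (Y : Set (Quotient F))
    (f : Quotient E → Quotient F) (k : ℕ),
    IsInterpretable L E X → IsInterpretable L F Y → IsInterpretableMap L X Y f →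
    (∀ y ∈ Y, dim M E (X ∩ f ⁻¹' {y}) ≤ (k : WithBot ℕ)) →
    dim M E X ≤ dim M F Y + (k : WithBot ℕ)

/-- The theory `T` is finite-dimensional. -/
def IsFiniteDimensionalTheory {L : FirstOrder.Language.{u, v}} (T : L.Theory) : Prop :=
  Nonempty (TheoryDimension.{u, v, w} T)

/-! ### Lie rings definable in a structure

A Lie ring in the sense of Mathlib is a Lie algebra over `ℤ`, its Lie subrings are its Lie
subalgebras over `ℤ`, and its ideals are its Lie ideals over `ℤ`. -/

/-- Coordinates for the elements of `𝔤` in the structure `M`: a map from a set of `n`-tuples of `M`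
onto `𝔤`. (The values of `toFun` outside `carrier` are irrelevant.) -/
structure Coordinates (M : Type*) (𝔤 : Type*) where
  arity : ℕ
  carrier : Set (Fin arity → M)
  toFun : (Fin arity → M) → 𝔤
  surjOn : Set.SurjOn toFun carrier Set.univ

namespace Coordinates

variable {M : Type*} {𝔤 𝔥 : Type*}

/-- A subset of `𝔤` is definable if the set of coordinate tuples of its elements is. -/
def IsDefinable (L : FirstOrder.Language) [L.Structure M] (c : Coordinates M 𝔤) (S : Set 𝔤) : Prop :=
  DefinableIn L {x : Fin c.arity → M | x ∈ c.carrier ∧ c.toFun x ∈ S}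

/-- The coordinates induced on the image of a surjection. -/
def push (c : Coordinates M 𝔤) (f : 𝔤 → 𝔥) (hf : Function.Surjective f) : Coordinates M 𝔥 where
  arity := c.arity
  carrier := c.carrier
  toFun := f ∘ c.toFun
  surjOn := by
    intro y _
    obtain ⟨z, rfl⟩ := hf y
    obtain ⟨x, hx, rfl⟩ := c.surjOn (Set.mem_univ z)
    exact ⟨x, hx, rfl⟩

/-- Through the coordinates `c`, the Lie ring `𝔤` is a definable Lie ring of `M`, possibly on
imaginary elements: it is a definable set modulo a definable equivalence relation, with definable
addition and definable bracket. If `c.toFun` is injective on `c.carrier`, then `𝔤` lives on a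
definable set of tuples. -/
structure IsDefinableLieRing (L : FirstOrder.Language) [L.Structure M] [LieRing 𝔤]
    (c : Coordinates M 𝔤) : Prop where
  carrier_definable : DefinableIn L c.carrier
  eq_definable : DefinableIn L {p : Fin c.arity ⊕ Fin c.arity → M |
    p ∘ Sum.inl ∈ c.carrier ∧ p ∘ Sum.inr ∈ c.carrier ∧
      c.toFun (p ∘ Sum.inl) = c.toFun (p ∘ Sum.inr)}
  add_definable : DefinableIn L {p : Fin c.arity ⊕ (Fin c.arity ⊕ Fin c.arity) → M |
    p ∘ Sum.inl ∈ c.carrier ∧ p ∘ Sum.inr ∘ Sum.inl ∈ c.carrier ∧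
      p ∘ Sum.inr ∘ Sum.inr ∈ c.carrier ∧
      c.toFun (p ∘ Sum.inl) + c.toFun (p ∘ Sum.inr ∘ Sum.inl) = c.toFun (p ∘ Sum.inr ∘ Sum.inr)}
  bracket_definable : DefinableIn L {p : Fin c.arity ⊕ (Fin c.arity ⊕ Fin c.arity) → M |
    p ∘ Sum.inl ∈ c.carrier ∧ p ∘ Sum.inr ∘ Sum.inl ∈ c.carrier ∧
      p ∘ Sum.inr ∘ Sum.inr ∈ c.carrier ∧
      ⁅c.toFun (p ∘ Sum.inl), c.toFun (p ∘ Sum.inr ∘ Sum.inl)⁆ = c.toFun (p ∘ Sum.inr ∘ Sum.inr)}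

end Coordinates

/-! ### Almost Lie ring theory -/

namespace LieRing

/-- The centraliser `{y | ⁅x, y⁆ = 0}` of an element, as a subgroup. -/
def elementCentralizer {𝔤 : Type*} [LieRing 𝔤] (x : 𝔤) : AddSubgroup 𝔤 where
  carrier := {y | ⁅x, y⁆ = 0}
  zero_mem' := by simp
  add_mem' := by
    intro a b ha hb
    simp only [Set.mem_ofPred_eq] at ha hb ⊢
    rw [lie_add, ha, hb, add_zero]
  neg_mem' := by
    intro a ha
    simp only [Set.mem_ofPred_eq] at ha ⊢
    rw [lie_neg, ha, neg_zero]

/-- The almost centre: the ideal of the elements whose centraliser has finite index. -/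
def almostCenter (𝔤 : Type*) [LieRing 𝔤] : LieIdeal ℤ 𝔤 where
  carrier := {x | (elementCentralizer x).FiniteIndex}
  zero_mem' := by
    have h : elementCentralizer (0 : 𝔤) = ⊤ := by
      ext y
      simp [elementCentralizer]
    simp only [Set.mem_ofPred_eq, h]
    infer_instance
  add_mem' := by
    intro a b ha hb
    simp only [Set.mem_ofPred_eq] at ha hb ⊢
    refine AddSubgroup.finiteIndex_of_le
      (H := elementCentralizer a ⊓ elementCentralizer b) ?_
    rintro y ⟨h1, h2⟩
    change ⁅a, y⁆ = 0 at h1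
    change ⁅b, y⁆ = 0 at h2
    change ⁅a + b, y⁆ = 0
    rw [add_lie, h1, h2, add_zero]
  smul_mem' := by
    intro k a ha
    simp only [Set.mem_ofPred_eq] at ha ⊢
    refine AddSubgroup.finiteIndex_of_le (H := elementCentralizer a) ?_
    intro y h1
    change ⁅a, y⁆ = 0 at h1
    change ⁅k • a, y⁆ = 0
    rw [zsmul_lie, h1, smul_zero]
  lie_mem := by
    intro g a ha
    change (elementCentralizer a).FiniteIndex at ha
    change (elementCentralizer ⁅g, a⁆).FiniteIndex
    let f : 𝔤 →+ 𝔤 := (LieAlgebra.ad ℤ 𝔤 g).toAddMonoidHom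
    have : ((elementCentralizer a).comap f).FiniteIndex := by
      constructor
      rw [AddSubgroup.index_comap]
      exact ne_zero_of_dvd_ne_zero ha.index_ne_zero (AddSubgroup.relIndex_dvd_index_of_normal _ _)
    refine AddSubgroup.finiteIndex_of_le
      (H := elementCentralizer a ⊓ (elementCentralizer a).comap f) ?_
    rintro y ⟨h1, h2⟩
    change ⁅a, y⁆ = 0 at h1
    change ⁅a, ⁅g, y⁆⁆ = 0 at h2
    change ⁅⁅g, a⁆, y⁆ = 0
    rw [lie_lie, h1, h2, lie_zero, sub_zero]

/-- A Lie ring is almost abelian if it equals its almost centre. -/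
def IsAlmostAbelian (𝔤 : Type*) [LieRing 𝔤] : Prop :=
  almostCenter 𝔤 = ⊤

/-- The ideal `I` of `𝔤` has an ideal almost abelian series: a series
`I = s 0 ≥ s 1 ≥ ... ≥ s n = 0` of ideals of `𝔤` with almost abelian quotients. (In particular `I`
is almost soluble.) -/
def HasIdealAlmostAbelianSeries {𝔤 : Type*} [LieRing 𝔤] (I : LieIdeal ℤ 𝔤) : Prop :=
  ∃ (n : ℕ) (s : ℕ → LieIdeal ℤ 𝔤), s 0 = I ∧ s n = ⊥ ∧
    ∀ i < n, s (i + 1) ≤ s i ∧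
      IsAlmostAbelian (↥(s i) ⧸ LieIdeal.comap (s i).incl (s (i + 1)))

/-- The almost radical ideal: the sum of all ideals with an ideal almost abelian series. -/
def almostRadical (𝔤 : Type*) [LieRing 𝔤] : LieIdeal ℤ 𝔤 :=
  sSup {I : LieIdeal ℤ 𝔤 | HasIdealAlmostAbelianSeries I}

/-- A Lie ring is virtually soluble if it has a soluble Lie subring of finite index. -/
def IsVirtuallySoluble (𝔤 : Type*) [LieRing 𝔤] : Prop :=
  ∃ S : LieSubalgebra ℤ 𝔤,
    S.toSubmodule.toAddSubgroup.FiniteIndex ∧ LieAlgebra.IsSolvable S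

/-- A Lie ring is semi-simple if it is not abelian and has no nonzero abelian ideal. -/
def IsSemiSimple (𝔤 : Type*) [LieRing 𝔤] : Prop :=
  ¬ IsLieAbelian 𝔤 ∧ ∀ I : LieIdeal ℤ 𝔤, IsLieAbelian I → I = ⊥

end LieRing

namespace Coordinates

variable {M : Type*} {𝔤 : Type*} [LieRing 𝔤]

/-- Absolute simplicity: no definable Lie subring of finite index has an infinite definable ideal of
infinite index. -/
def IsAbsolutelySimple (L : FirstOrder.Language) [L.Structure M] (c : Coordinates M 𝔤) : Prop :=
  ∀ H : LieSubalgebra ℤ 𝔤, c.IsDefinable L (H : Set 𝔤) →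
    H.toSubmodule.toAddSubgroup.FiniteIndex →
    ¬ ∃ I : LieIdeal ℤ H, c.IsDefinable L ((↑) '' (I : Set H) : Set 𝔤) ∧
      (I : Set H).Infinite ∧ ¬ I.toSubmodule.toAddSubgroup.FiniteIndex

/-- `𝔤` is virtually almost abelian: some definable Lie subring of finite index is almost
abelian. -/
def IsVirtuallyAlmostAbelian (L : FirstOrder.Language) [L.Structure M] (c : Coordinates M 𝔤) : Prop :=
  ∃ H : LieSubalgebra ℤ 𝔤, c.IsDefinable L (H : Set 𝔤) ∧
    H.toSubmodule.toAddSubgroup.FiniteIndex ∧ LieRing.IsAlmostAbelian H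

/-- The coordinates induced on the quotient by an ideal. -/
def quotient (c : Coordinates M 𝔤) (I : LieIdeal ℤ 𝔤) : Coordinates M (𝔤 ⧸ I) :=
  c.push (fun x => LieSubmodule.Quotient.mk (N := I) x) (Submodule.Quotient.mk_surjective _)

end Coordinates

-- Two consequences of finite dimension carry the proof. First, a definable subgroup `H` of infinite
-- index in `K` has smaller dimension, because the fibres of `K → K/H` are cosets of `H` and the
-- infinite set `K/H` has dimension at least one (`TheoryDimension.exists_rank`). Second, the finite
-- indices of centralisers in a definable subgroup are bounded
-- (`TheoryDimension.exists_relIndex_centralizer_le`): otherwise an ultrapower, again a model of the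
-- theory, would contain an infinite chain of definable subgroups, each of infinite index in the one
-- before.
--
-- The bound makes almost centralisers definable and almost centralisation symmetric. It also gives
-- Neumann's theorem: a definable almost abelian ideal `B` has finite `[B,B]`, so the centraliser of
-- `[B,B]` in `B` is a definable soluble ideal of finite index in `B`. Moreover an infinite almost
-- abelian ideal `J`, definable or not, yields an infinite definable one. Intersecting centralisers
-- of elements of `J` until the rank is least gives a subgroup `C` almost centralised by `J`; its
-- almost centraliser `A` is a definable ideal containing `J`, and the intersection of `A` with its
-- own almost centraliser is almost abelian and contains `J` up to finite index.
--
-- For the radicals, take a definable soluble ideal `S`, maximal up to finite index. By the above,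
-- every almost abelian ideal of `𝔤/S` is finite. Climbing a series, every ideal with an almost
-- abelian series is finite modulo `S`, hence lies modulo `S` in the almost centre of `𝔤/S`, which
-- is almost abelian and so finite. Thus `S` has finite index in the almost radical, and everything
-- claimed about both radicals follows.
--
-- In an absolutely simple ring infinite definable ideals have finite index, so the almost centre is
-- finite unless the ring is virtually almost abelian. Modulo a finite almost centre the almost
-- centre is zero. A finite abelian ideal of the quotient lies in it; an infinite one would give a
-- definable almost abelian ideal of finite index, whose preimage is again almost abelian.

universe z'

/-! ### Definable relations on a group with coordinates -/

/-- Specialising some variables of a definable set to parameters. -/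
theorem DefinableIn.specialize {L : FirstOrder.Language.{u, v}} {M : Type w} [L.Structure M]
    {α β : Type*} [Finite α] [Finite β] {S : Set (α ⊕ β → M)} (hS : DefinableIn L S) (b : β → M) :
    DefinableIn L {x : α → M | Sum.elim x b ∈ S} := by
  refine Set.Definable.preimage_map (F := fun x => Sum.elim x b) ?_ hS
  rintro (i | i)
  · exact Set.DefinableFun.proj L
  · exact Language.definableFun_const L α (Set.mem_univ (b i))

namespace Coordinates

variable {L : FirstOrder.Language.{u, v}} {M : Type w} [L.Structure M] {G : Type z}

variable (L) in
/-- A relation on `G` is definable if the set of coordinate tuples of its elements is. -/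
def DefRel (c : Coordinates M G) {ι : Type*} (P : (ι → G) → Prop) : Prop :=
  DefinableIn L {x : ι × Fin c.arity → M | (∀ i, (fun j => x (i, j)) ∈ c.carrier) ∧
    P (fun i => c.toFun fun j => x (i, j))}

variable (L) in
/-- A function of several variables on `G` is definable if its graph is. -/
def DefFun (c : Coordinates M G) {ι : Type*} (t : (ι → G) → G) : Prop :=
  c.DefRel L fun v : ι ⊕ Unit → G => t (v ∘ Sum.inl) = v (Sum.inr ())

/-- The additive part of `IsDefinableLieRing`. -/
structure IsDefinableAddGroup (L : FirstOrder.Language) [L.Structure M] [AddCommGroup G]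
    (c : Coordinates M G) : Prop where
  carrier_definable : DefinableIn L c.carrier
  eq_definable : DefinableIn L {p : Fin c.arity ⊕ Fin c.arity → M |
    p ∘ Sum.inl ∈ c.carrier ∧ p ∘ Sum.inr ∈ c.carrier ∧
      c.toFun (p ∘ Sum.inl) = c.toFun (p ∘ Sum.inr)}
  add_definable : DefinableIn L {p : Fin c.arity ⊕ (Fin c.arity ⊕ Fin c.arity) → M |
    p ∘ Sum.inl ∈ c.carrier ∧ p ∘ Sum.inr ∘ Sum.inl ∈ c.carrier ∧
      p ∘ Sum.inr ∘ Sum.inr ∈ c.carrier ∧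
      c.toFun (p ∘ Sum.inl) + c.toFun (p ∘ Sum.inr ∘ Sum.inl) = c.toFun (p ∘ Sum.inr ∘ Sum.inr)}

theorem IsDefinableLieRing.toIsDefinableAddGroup [LieRing G] {c : Coordinates M G}
    (hc : c.IsDefinableLieRing L) : c.IsDefinableAddGroup L :=
  ⟨hc.carrier_definable, hc.eq_definable, hc.add_definable⟩

section DefRel

variable {c : Coordinates M G} {ι κ : Type*} {P Q : (ι → G) → Prop}

theorem DefRel.congr (h : ∀ v, P v ↔ Q v) (hP : c.DefRel L P) : c.DefRel L Q := by
  rwa [show Q = P from funext fun v => propext (h v).symm]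

theorem definableIn_forall_mem_carrier [Finite ι] (hc : DefinableIn L c.carrier) :
    DefinableIn L {x : ι × Fin c.arity → M | ∀ i, (fun j => x (i, j)) ∈ c.carrier} := by
  rw [Set.ofPred_forall]
  exact Set.definable_iInter_of_finite fun i => Set.Definable.preimage_comp (fun j => (i, j)) hc

theorem DefRel.and (hP : c.DefRel L P) (hQ : c.DefRel L Q) :
    c.DefRel L fun v => P v ∧ Q v := by
  refine (congrArg (DefinableIn L) ?_).mp (Set.Definable.inter hP hQ)
  ext x
  simp only [Set.mem_inter_iff, Set.mem_ofPred_eq]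
  tauto

theorem DefRel.not [Finite ι] (hc : DefinableIn L c.carrier) (hP : c.DefRel L P) :
    c.DefRel L fun v => ¬ P v := by
  refine (congrArg (DefinableIn L) ?_).mp
    (Set.Definable.sdiff (definableIn_forall_mem_carrier (ι := ι) hc) hP)
  ext x
  simp only [Set.mem_sdiff, Set.mem_ofPred_eq]
  tauto

theorem DefRel.forall_finite [Finite ι] [Finite κ] (hc : DefinableIn L c.carrier)
    {R : κ → (ι → G) → Prop} (hR : ∀ k, c.DefRel L (R k)) :
    c.DefRel L fun v => ∀ k, R k v := by
  refine (congrArg (DefinableIn L) ?_).mp (Set.Definable.inter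
    (definableIn_forall_mem_carrier (ι := ι) hc) (Set.definable_iInter_of_finite hR))
  ext x
  simp only [Set.mem_inter_iff, Set.mem_ofPred_eq, Set.mem_iInter]
  refine ⟨fun h => ⟨h.1, fun k => (h.2 k).2⟩, fun h => ⟨h.1, fun k => ⟨h.1, h.2 k⟩⟩⟩

theorem DefRel.reindex [Finite κ] (hc : DefinableIn L c.carrier) (hP : c.DefRel L P) (f : ι → κ) :
    c.DefRel L fun v : κ → G => P (v ∘ f) := by
  refine (congrArg (DefinableIn L) ?_).mp (Set.Definable.inter
    (definableIn_forall_mem_carrier (ι := κ) hc)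
    (Set.Definable.preimage_comp (fun p : ι × Fin c.arity => (f p.1, p.2)) hP))
  ext x
  simp only [Set.mem_inter_iff, Set.mem_preimage, Set.mem_ofPred_eq, Function.comp_def]
  exact ⟨fun h => ⟨h.1, h.2.2⟩, fun h => ⟨h.1, fun i => h.1 (f i), h.2⟩⟩

/-- Every element of `G` has coordinates in the carrier, so a quantifier over `G` is a quantifier
over tuples of `M`. -/
theorem DefRel.exists [Finite κ] {R : (ι → G) → (κ → G) → Prop}
    (hR : c.DefRel L fun v : ι ⊕ κ → G => R (v ∘ Sum.inl) (v ∘ Sum.inr)) :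
    c.DefRel L fun v => ∃ y, R v y := by
  have h := Set.Definable.exists_of_finite (Set.Definable.image_comp_equiv hR
    (Equiv.sumProdDistrib ι κ (Fin c.arity)).symm)
  refine (congrArg (DefinableIn L) ?_).mp h
  ext x
  simp only [Set.mem_ofPred_eq, Set.mem_image]
  constructor
  · rintro ⟨y, t, ⟨ht, htR⟩, hxy⟩
    have h1 : ∀ i, (fun j => t (Sum.inl i, j)) = fun j => x (i, j) := fun i => funext fun j =>
      congrFun hxy (Sum.inl (i, j))
    refine ⟨fun i => h1 i ▸ ht (Sum.inl i), fun k => c.toFun fun j => t (Sum.inr k, j), ?_⟩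
    simpa only [Function.comp_def, h1] using htR
  · rintro ⟨hx, y, hy⟩
    choose y' hy' hyy using fun k => c.surjOn (Set.mem_univ (y k))
    refine ⟨fun p => y' p.1 p.2, fun p => Sum.elim (fun i => x (i, p.2)) (fun k => y' k p.2) p.1,
      ⟨?_, ?_⟩, ?_⟩
    · rintro (i | k)
      · exact hx i
      · exact hy' k
    · simpa only [Function.comp_def, Sum.elim_inl, Sum.elim_inr, hyy] using hy
    · ext (p | p) <;> rfl

theorem DefFun.reindex [Finite κ] (hc : DefinableIn L c.carrier) {t : (ι → G) → G}
    (ht : c.DefFun L t) (f : ι → κ) : c.DefFun L fun v : κ → G => t (v ∘ f) :=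
  DefRel.reindex hc ht (Sum.map f id)

/-- Substituting definable functions into a definable relation. -/
theorem DefRel.comp [Finite ι] [Finite κ] (hc : DefinableIn L c.carrier) {R : (κ → G) → Prop}
    (hR : c.DefRel L R) {t : κ → (ι → G) → G} (ht : ∀ k, c.DefFun L (t k)) :
    c.DefRel L fun v => R fun k => t k v := by
  have h : c.DefRel L fun v : ι ⊕ κ → G =>
      (∀ k, t k (v ∘ Sum.inl) = v (Sum.inr k)) ∧ R (v ∘ Sum.inr) := by
    refine DefRel.and (DefRel.forall_finite hc fun k => ?_) (hR.reindex hc Sum.inr)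
    exact DefRel.reindex hc (ht k) (Sum.map id fun _ => k)
  refine (DefRel.exists (R := fun v y => (∀ k, t k v = y k) ∧ R y) h).congr fun v => ?_
  constructor
  · rintro ⟨y, hy, hR⟩
    rwa [show (fun k => t k v) = y from funext hy]
  · exact fun hv => ⟨_, fun k => rfl, hv⟩

theorem DefRel.isDefinable {R : G → Prop} (h : c.DefRel L fun v : Unit → G => R (v ())) :
    c.IsDefinable L {x | R x} := by
  refine (congrArg (DefinableIn L) ?_).mp
    (Set.Definable.image_comp_equiv h (Equiv.punitProd (Fin c.arity)).symm)
  ext x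
  simp only [Set.mem_image, Set.mem_ofPred_eq]
  constructor
  · rintro ⟨y, ⟨h1, h2⟩, rfl⟩
    exact ⟨h1 (), h2⟩
  · rintro ⟨h1, h2⟩
    exact ⟨fun p => x p.2, ⟨fun _ => h1, h2⟩, rfl⟩

theorem IsDefinable.defRel {S : Set G} (hS : c.IsDefinable L S) :
    c.DefRel L fun v : Unit → G => v () ∈ S := by
  refine (congrArg (DefinableIn L) ?_).mp
    (Set.Definable.image_comp_equiv hS (Equiv.punitProd (Fin c.arity)))
  ext x
  simp only [Set.mem_image, Set.mem_ofPred_eq]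
  constructor
  · rintro ⟨y, ⟨h1, h2⟩, rfl⟩
    exact ⟨fun _ => h1, h2⟩
  · rintro ⟨h1, h2⟩
    exact ⟨fun j => x ((), j), ⟨h1 (), h2⟩, rfl⟩

theorem IsDefinable.mem [Finite ι] (hc : DefinableIn L c.carrier) {S : Set G}
    (hS : c.IsDefinable L S) {t : (ι → G) → G} (ht : c.DefFun L t) :
    c.DefRel L fun v => t v ∈ S :=
  hS.defRel.comp hc (t := fun _ => t) fun _ => ht

theorem IsDefinable.inter {S T : Set G} (hS : c.IsDefinable L S) (hT : c.IsDefinable L T) :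
    c.IsDefinable L (S ∩ T) :=
  DefRel.isDefinable (hS.defRel.and hT.defRel)

theorem isDefinable_univ (hc : DefinableIn L c.carrier) : c.IsDefinable L (Set.univ : Set G) := by
  simpa [IsDefinable] using hc

/-- The set of pairs of coordinate tuples satisfying a binary definable relation. -/
theorem DefRel.definableIn₂ {R : G → G → Prop}
    (h : c.DefRel L fun v : Unit ⊕ Unit → G => R (v (Sum.inl ())) (v (Sum.inr ()))) :
    DefinableIn L {p : Fin c.arity ⊕ Fin c.arity → M | p ∘ Sum.inl ∈ c.carrier ∧
      p ∘ Sum.inr ∈ c.carrier ∧ R (c.toFun (p ∘ Sum.inl)) (c.toFun (p ∘ Sum.inr))} := by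
  let e : (Unit ⊕ Unit) × Fin c.arity ≃ Fin c.arity ⊕ Fin c.arity :=
    (Equiv.sumProdDistrib _ _ _).trans
      (Equiv.sumCongr (Equiv.punitProd _) (Equiv.punitProd _))
  refine (congrArg (DefinableIn L) ?_).mp (Set.Definable.preimage_comp e h)
  ext x
  simp only [Set.mem_preimage, Set.mem_ofPred_eq, Sum.forall, and_assoc]
  exact ⟨fun h => ⟨h.1 (), h.2.1 (), h.2.2⟩, fun h => ⟨fun _ => h.1, fun _ => h.2.1, h.2.2⟩⟩

/-- The set of triples of coordinate tuples satisfying a ternary definable relation. -/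
theorem DefRel.definableIn₃ {R : G → G → G → Prop}
    (h : c.DefRel L fun v : Unit ⊕ (Unit ⊕ Unit) → G =>
      R (v (Sum.inl ())) (v (Sum.inr (Sum.inl ()))) (v (Sum.inr (Sum.inr ())))) :
    DefinableIn L {p : Fin c.arity ⊕ (Fin c.arity ⊕ Fin c.arity) → M | p ∘ Sum.inl ∈ c.carrier ∧
      p ∘ Sum.inr ∘ Sum.inl ∈ c.carrier ∧ p ∘ Sum.inr ∘ Sum.inr ∈ c.carrier ∧
      R (c.toFun (p ∘ Sum.inl)) (c.toFun (p ∘ Sum.inr ∘ Sum.inl))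
        (c.toFun (p ∘ Sum.inr ∘ Sum.inr))} := by
  let e : (Unit ⊕ (Unit ⊕ Unit)) × Fin c.arity ≃ Fin c.arity ⊕ (Fin c.arity ⊕ Fin c.arity) :=
    (Equiv.sumProdDistrib _ _ _).trans (Equiv.sumCongr (Equiv.punitProd _)
      ((Equiv.sumProdDistrib _ _ _).trans
        (Equiv.sumCongr (Equiv.punitProd _) (Equiv.punitProd _))))
  refine (congrArg (DefinableIn L) ?_).mp (Set.Definable.preimage_comp e h)
  ext x
  simp only [Set.mem_preimage, Set.mem_ofPred_eq, Sum.forall, and_assoc]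
  exact ⟨fun h => ⟨h.1 (), h.2.1 (), h.2.2.1 (), h.2.2.2⟩,
    fun h => ⟨fun _ => h.1, fun _ => h.2.1, fun _ => h.2.2.1, h.2.2.2⟩⟩

theorem defRel_ternary {R : G → G → G → Prop}
    (h : DefinableIn L {p : Fin c.arity ⊕ (Fin c.arity ⊕ Fin c.arity) → M | p ∘ Sum.inl ∈ c.carrier ∧
      p ∘ Sum.inr ∘ Sum.inl ∈ c.carrier ∧ p ∘ Sum.inr ∘ Sum.inr ∈ c.carrier ∧
      R (c.toFun (p ∘ Sum.inl)) (c.toFun (p ∘ Sum.inr ∘ Sum.inl))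
        (c.toFun (p ∘ Sum.inr ∘ Sum.inr))}) :
    c.DefRel L fun v : Fin 3 → G => R (v 0) (v 1) (v 2) := by
  let e : Fin c.arity ⊕ (Fin c.arity ⊕ Fin c.arity) → Fin 3 × Fin c.arity :=
    Sum.elim (fun j => (0, j)) (Sum.elim (fun j => (1, j)) fun j => (2, j))
  refine (congrArg (DefinableIn L) ?_).mp (Set.Definable.preimage_comp e h)
  ext x
  simp only [Set.mem_preimage, Set.mem_ofPred_eq, Fin.forall_fin_succ, Fin.forall_fin_zero,
    and_true, and_assoc]
  rfl

end DefRel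

section AddGroup

variable [AddCommGroup G] {c : Coordinates M G} {ι : Type*} [Finite ι]

theorem IsDefinableAddGroup.proj (hc : c.IsDefinableAddGroup L) (i : ι) :
    c.DefFun L fun v : ι → G => v i := by
  let e : Fin c.arity ⊕ Fin c.arity → (ι ⊕ Unit) × Fin c.arity :=
    Sum.elim (fun j => (Sum.inl i, j)) (fun j => (Sum.inr (), j))
  refine (congrArg (DefinableIn L) ?_).mp (Set.Definable.inter
    (definableIn_forall_mem_carrier (ι := ι ⊕ Unit) hc.carrier_definable)
    (Set.Definable.preimage_comp e hc.eq_definable))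
  ext x
  simp only [Set.mem_inter_iff, Set.mem_preimage, Set.mem_ofPred_eq, Function.comp_def]
  exact ⟨fun h => ⟨h.1, h.2.2.2⟩, fun h => ⟨h.1, h.1 _, h.1 _, h.2⟩⟩

theorem IsDefinableAddGroup.const (hc : c.IsDefinableAddGroup L) (g : G) :
    c.DefFun L fun _ : ι → G => g := by
  obtain ⟨b, hb, rfl⟩ := c.surjOn (Set.mem_univ g)
  have h := DefinableIn.specialize hc.eq_definable b
  let e : Fin c.arity → (ι ⊕ Unit) × Fin c.arity := fun j => (Sum.inr (), j)
  refine (congrArg (DefinableIn L) ?_).mp (Set.Definable.inter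
    (definableIn_forall_mem_carrier (ι := ι ⊕ Unit) hc.carrier_definable)
    (Set.Definable.preimage_comp e h))
  ext x
  simp only [Set.mem_inter_iff, Set.mem_preimage, Set.mem_ofPred_eq, Sum.elim_comp_inl,
    Sum.elim_comp_inr]
  exact ⟨fun h => ⟨h.1, h.2.2.2.symm⟩, fun h => ⟨h.1, h.1 _, hb, h.2.symm⟩⟩

theorem IsDefinableAddGroup.eq (hc : c.IsDefinableAddGroup L) {s t : (ι → G) → G}
    (hs : c.DefFun L s) (ht : c.DefFun L t) : c.DefRel L fun v => s v = t v :=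
  DefRel.comp hc.carrier_definable (hc.proj (ι := Unit) ())
    (t := Sum.elim (fun _ => s) fun _ => t) (by rintro (_ | _) <;> assumption)

theorem DefFun.of_ternary (hc : c.IsDefinableAddGroup L) {R : G → G → G → Prop}
    (hR : c.DefRel L fun v : Fin 3 → G => R (v 0) (v 1) (v 2)) {f : (Fin 3 → (ι ⊕ Unit → G) → G)}
    (hf : ∀ i, c.DefFun L (f i)) {r : (ι → G) → G}
    (h : ∀ v : ι ⊕ Unit → G, R (f 0 v) (f 1 v) (f 2 v) ↔ r (v ∘ Sum.inl) = v (Sum.inr ())) :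
    c.DefFun L r :=
  (hR.comp hc.carrier_definable hf).congr h

theorem IsDefinableAddGroup.add (hc : c.IsDefinableAddGroup L) {s t : (ι → G) → G}
    (hs : c.DefFun L s) (ht : c.DefFun L t) : c.DefFun L fun v => s v + t v := by
  refine DefFun.of_ternary hc (R := fun x y z => x + y = z)
    (defRel_ternary (R := fun x y z => x + y = z) hc.add_definable)
    (f := ![fun v => s (v ∘ Sum.inl), fun v => t (v ∘ Sum.inl), fun v => v (Sum.inr ())]) ?_
    fun v => Iff.rfl
  intro i
  fin_cases i
  · exact hs.reindex hc.carrier_definable _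
  · exact ht.reindex hc.carrier_definable _
  · exact hc.proj _

theorem IsDefinableAddGroup.sub (hc : c.IsDefinableAddGroup L) {s t : (ι → G) → G}
    (hs : c.DefFun L s) (ht : c.DefFun L t) : c.DefFun L fun v => s v - t v := by
  -- The difference is the solution `z` of `z + t = s`, so the graph of addition suffices.
  refine DefFun.of_ternary hc (R := fun x y z => x + y = z)
    (defRel_ternary (R := fun x y z => x + y = z) hc.add_definable)
    (f := ![fun v => v (Sum.inr ()), fun v => t (v ∘ Sum.inl), fun v => s (v ∘ Sum.inl)]) ?_
    fun v => ?_
  · intro i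
    fin_cases i
    · exact hc.proj _
    · exact ht.reindex hc.carrier_definable _
    · exact hs.reindex hc.carrier_definable _
  · exact eq_sub_iff_add_eq.symm.trans eq_comm

end AddGroup

theorem IsDefinableLieRing.bracket [LieRing G] {c : Coordinates M G}
    (hc : c.IsDefinableLieRing L) {ι : Type*} [Finite ι] {s t : (ι → G) → G}
    (hs : c.DefFun L s) (ht : c.DefFun L t) : c.DefFun L fun v => ⁅s v, t v⁆ := by
  have hA := hc.toIsDefinableAddGroup
  refine DefFun.of_ternary hA (R := fun x y z => ⁅x, y⁆ = z)
    (defRel_ternary (R := fun x y z => ⁅x, y⁆ = z) hc.bracket_definable)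
    (f := ![fun v => s (v ∘ Sum.inl), fun v => t (v ∘ Sum.inl), fun v => v (Sum.inr ())]) ?_
    fun v => Iff.rfl
  intro i
  fin_cases i
  · exact hs.reindex hc.carrier_definable _
  · exact ht.reindex hc.carrier_definable _
  · exact hA.proj _

/-- A subgroup in which a definable subgroup has finite index is definable. -/
theorem IsDefinable.of_relIndex_ne_zero [AddCommGroup G] {c : Coordinates M G}
    (hc : c.IsDefinableAddGroup L) {H K : AddSubgroup G} (hH : c.IsDefinable L (H : Set G))
    (hHK : H ≤ K) (h : H.relIndex K ≠ 0) : c.IsDefinable L (K : Set G) := by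
  have hfin : Finite (K ⧸ H.addSubgroupOf K) :=
    @AddSubgroup.finite_quotient_of_finiteIndex _ _ (H.addSubgroupOf K) ⟨h⟩
  -- `K` is the union of finitely many cosets of `H`; the union is written as `¬ ∀ ¬` to use closure
  -- under negation and finite conjunction.
  have hR : c.DefRel L fun v : Unit → G => ¬ ∀ q : K ⧸ H.addSubgroupOf K,
      ¬ (v () - (q.out : G) ∈ (H : Set G)) :=
    DefRel.not hc.carrier_definable (DefRel.forall_finite hc.carrier_definable fun q =>
      DefRel.not hc.carrier_definable
        (hH.mem hc.carrier_definable (hc.sub (hc.proj ()) (hc.const _))))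
  refine (congrArg (c.IsDefinable L) ?_).mp
    (DefRel.isDefinable (R := fun x => ¬ ∀ q : K ⧸ H.addSubgroupOf K,
      ¬ (x - (q.out : G) ∈ (H : Set G))) hR)
  ext x
  simp only [not_forall, not_not, Set.mem_ofPred_eq, SetLike.mem_coe]
  constructor
  · rintro ⟨q, hq⟩
    simpa using K.add_mem (hHK hq) q.out.2
  · intro hx
    refine ⟨QuotientAddGroup.mk ⟨x, hx⟩, ?_⟩
    have := (QuotientAddGroup.eq (s := H.addSubgroupOf K)).mp
      (QuotientAddGroup.out_eq' (QuotientAddGroup.mk (s := H.addSubgroupOf K) ⟨x, hx⟩))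
    rw [AddSubgroup.mem_addSubgroupOf] at this
    simpa [sub_eq_neg_add] using this

end Coordinates

/-! ### The rank on definable subgroups -/

namespace Coordinates

variable {L : FirstOrder.Language.{u, v}} {M : Type w} {G : Type z} [AddCommGroup G]

/-- Congruence of coordinate tuples modulo a subgroup. -/
def cosetSetoid (c : Coordinates M G) (H : AddSubgroup G) : Setoid (Fin c.arity → M) where
  -- Interpretable sets live in quotients of the whole of `Mⁿ`, so the tuples outside the carrier
  -- are put into one extra class.
  r x y := (x ∈ c.carrier ∧ y ∈ c.carrier ∧ c.toFun x - c.toFun y ∈ H) ∨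
    (x ∉ c.carrier ∧ y ∉ c.carrier)
  iseqv := by
    refine ⟨fun x => ?_, fun {x y} h => ?_, fun {x y z} h h' => ?_⟩
    · by_cases hx : x ∈ c.carrier <;> simp [hx]
    · rcases h with ⟨h1, h2, h3⟩ | ⟨h1, h2⟩
      · exact Or.inl ⟨h2, h1, by simpa using H.neg_mem h3⟩
      · exact Or.inr ⟨h2, h1⟩
    · rcases h with ⟨h1, h2, h3⟩ | ⟨h1, h2⟩ <;> rcases h' with ⟨h4, h5, h6⟩ | ⟨h4, h5⟩
      · exact Or.inl ⟨h1, h5, by simpa using H.add_mem h3 h6⟩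
      · exact absurd h2 h4
      · exact absurd h4 h2
      · exact Or.inr ⟨h1, h5⟩

/-- The class of coordinate tuples representing the coset of an element. -/
noncomputable def cosetClass (c : Coordinates M G) (H : AddSubgroup G) (g : G) :
    Quotient (c.cosetSetoid H) :=
  Quotient.mk _ (c.surjOn (Set.mem_univ g)).choose

variable {c : Coordinates M G} {H : AddSubgroup G}

theorem cosetClass_eq_mk_iff {g : G} {x : Fin c.arity → M} :
    c.cosetClass H g = Quotient.mk _ x ↔ x ∈ c.carrier ∧ c.toFun x - g ∈ H := by
  obtain ⟨h1, h2⟩ := (c.surjOn (Set.mem_univ g)).choose_spec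
  rw [cosetClass, Quotient.eq]
  change (_ ∨ _) ↔ _
  rw [h2, ← neg_mem_iff (x := g - _), neg_sub]
  tauto

theorem cosetClass_toFun {x : Fin c.arity → M} (hx : x ∈ c.carrier) :
    c.cosetClass H (c.toFun x) = Quotient.mk _ x :=
  cosetClass_eq_mk_iff.mpr ⟨hx, by simp⟩

theorem cosetClass_eq_iff {g h : G} : c.cosetClass H g = c.cosetClass H h ↔ h - g ∈ H := by
  obtain ⟨x, hx, rfl⟩ := c.surjOn (Set.mem_univ h)
  rw [cosetClass_toFun hx, cosetClass_eq_mk_iff]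
  exact and_iff_right hx

theorem cosetClass_bot_injective : Function.Injective (c.cosetClass (⊥ : AddSubgroup G)) := by
  intro g h hgh
  rw [cosetClass_eq_iff, AddSubgroup.mem_bot, sub_eq_zero] at hgh
  exact hgh.symm

theorem mk_mem_image_cosetClass {S : Set G} (hS : ∀ x y, x - y ∈ H → y ∈ S → x ∈ S)
    {x : Fin c.arity → M} :
    Quotient.mk _ x ∈ c.cosetClass H '' S ↔ x ∈ c.carrier ∧ c.toFun x ∈ S := by
  constructor
  · rintro ⟨g, hg, h⟩
    rw [cosetClass_eq_mk_iff] at h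
    exact ⟨h.1, hS _ _ h.2 hg⟩
  · rintro ⟨h1, h2⟩
    exact ⟨_, h2, cosetClass_toFun h1⟩

variable [L.Structure M]

theorem isInterpretable_image_cosetClass (hc : c.IsDefinableAddGroup L)
    (hH : c.IsDefinable L (H : Set G)) {S : Set G} (hS : ∀ x y, x - y ∈ H → y ∈ S → x ∈ S)
    (hSd : c.IsDefinable L S) : IsInterpretable L (c.cosetSetoid H) (c.cosetClass H '' S) := by
  constructor
  · have h1 := DefRel.definableIn₂ (R := fun x y => x - y ∈ (H : Set G))
      (hH.mem hc.carrier_definable (hc.sub (hc.proj _) (hc.proj _)))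
    have h2 : DefinableIn L {p : Fin c.arity ⊕ Fin c.arity → M |
        p ∘ Sum.inl ∉ c.carrier ∧ p ∘ Sum.inr ∉ c.carrier} :=
      Set.Definable.inter (Set.Definable.preimage_comp _ hc.carrier_definable.compl)
        (Set.Definable.preimage_comp _ hc.carrier_definable.compl)
    exact Set.Definable.union h1 h2
  · refine (congrArg (DefinableIn L) ?_).mp hSd
    ext x
    exact (mk_mem_image_cosetClass hS).symm

/-- Translation by `a`, followed by reduction modulo `H`, on classes of coordinate tuples. -/
noncomputable def translate (c : Coordinates M G) (H : AddSubgroup G) (a : G)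
    (q : Quotient (c.cosetSetoid ⊥)) : Quotient (c.cosetSetoid H) :=
  c.cosetClass H (Function.invFun (c.cosetClass ⊥) q + a)

omit [L.Structure M] in
theorem translate_cosetClass (a g : G) :
    c.translate H a (c.cosetClass ⊥ g) = c.cosetClass H (g + a) := by
  rw [translate, Function.leftInverse_invFun cosetClass_bot_injective g]

theorem isInterpretableMap_translate (hc : c.IsDefinableAddGroup L)
    (hH : c.IsDefinable L (H : Set G)) {S S' : Set G} (hS : c.IsDefinable L S) {a : G}
    (h : ∀ x ∈ S, x + a ∈ S') :
    IsInterpretableMap L (c.cosetClass ⊥ '' S) (c.cosetClass H '' S') (c.translate H a) := by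
  constructor
  · rintro _ ⟨g, hg, rfl⟩
    exact ⟨g + a, h g hg, (translate_cosetClass a g).symm⟩
  · have h1 := DefRel.definableIn₂ (R := fun x y => x ∈ S ∧ y - (x + a) ∈ (H : Set G))
      ((hS.mem hc.carrier_definable (hc.proj _)).and (hH.mem hc.carrier_definable
        (hc.sub (hc.proj _) (hc.add (hc.proj _) (hc.const a)))))
    refine (congrArg (DefinableIn L) ?_).mp h1
    ext p
    simp only [Set.mem_ofPred_eq]
    rw [mk_mem_image_cosetClass (fun x y hxy hy => by
      rw [AddSubgroup.mem_bot, sub_eq_zero] at hxy; rwa [hxy])]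
    constructor
    · rintro ⟨h1, h2, h3, h4⟩
      refine ⟨⟨h1, h3⟩, ?_⟩
      rw [← cosetClass_toFun h1, translate_cosetClass, cosetClass_eq_mk_iff]
      exact ⟨h2, h4⟩
    · rintro ⟨⟨h1, h3⟩, h4⟩
      rw [← cosetClass_toFun h1, translate_cosetClass, cosetClass_eq_mk_iff] at h4
      exact ⟨h1, h4.1, h3, h4.2⟩

theorem IsDefinable.coset (hc : c.IsDefinableAddGroup L) (hH : c.IsDefinable L (H : Set G))
    (a : G) : c.IsDefinable L {x | x - a ∈ H} :=
  DefRel.isDefinable (R := fun x => x - a ∈ (H : Set G))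
    (hH.mem hc.carrier_definable (hc.sub (hc.proj _) (hc.const a)))

theorem isDefinable_bot (hc : c.IsDefinableAddGroup L) :
    c.IsDefinable L ((⊥ : AddSubgroup G) : Set G) :=
  DefRel.isDefinable (R := fun x => x = 0) (hc.eq (hc.proj _) (hc.const 0))

end Coordinates

namespace TheoryDimension

open Coordinates

variable {L : FirstOrder.Language.{u, v}} {T : L.Theory} (D : TheoryDimension.{u, v, w} T)
  {M : Type w} [L.Structure M] [Nonempty M] [M ⊨ T] {G : Type z} [AddCommGroup G]
  {c : Coordinates M G}

/-- The set contains the class of `a`, a finite set and so of dimension 0, and dimension is monotone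
by the law for unions. -/
theorem dim_nonneg_image_cosetClass (hc : c.IsDefinableAddGroup L) {H : AddSubgroup G}
    (hH : c.IsDefinable L (H : Set G)) {S : Set G} (hS : ∀ x y, x - y ∈ H → y ∈ S → x ∈ S)
    (hSd : c.IsDefinable L S) {a : G} (ha : a ∈ S) :
    0 ≤ D.dim M (c.cosetSetoid H) (c.cosetClass H '' S) := by
  have h1 := isInterpretable_image_cosetClass hc hH
    (S := {x | x - a ∈ H}) (fun x y hxy hy => by simpa using H.add_mem hxy hy) (hH.coset hc a)
  have h2 : c.cosetClass H '' {x | x - a ∈ H} = {c.cosetClass H a} := by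
    ext q
    constructor
    · rintro ⟨x, hx, rfl⟩
      exact (cosetClass_eq_iff.mpr hx).symm
    · rintro rfl
      exact ⟨a, by simp, rfl⟩
  have h3 : D.dim M (c.cosetSetoid H) (c.cosetClass H '' {x | x - a ∈ H}) = 0 := by
    rw [D.dim_eq_zero_iff M _ _ h1 (by simp [h2]), h2]
    exact Set.finite_singleton _
  have h4 := D.dim_union M _ _ _ h1 (isInterpretable_image_cosetClass hc hH hS hSd)
  rw [← Set.image_union, Set.union_eq_self_of_subset_left, h3] at h4
  · rw [h4]
    exact le_max_left _ _
  · exact fun x hx => hS x a hx ha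

/-- Translation by `-a` maps the coset onto `H` with one-point fibres, which have dimension at least
0. Only this inequality is needed to bound the fibres of `K → K/H` from below. -/
theorem dim_subgroup_le_dim_coset (hc : c.IsDefinableAddGroup L) {H : AddSubgroup G}
    (hH : c.IsDefinable L (H : Set G)) (a : G) :
    D.dim M (c.cosetSetoid ⊥) (c.cosetClass ⊥ '' (H : Set G)) ≤
      D.dim M (c.cosetSetoid ⊥) (c.cosetClass ⊥ '' {x | x - a ∈ H}) := by
  have hb := isDefinable_bot (L := L) hc
  have hinv : ∀ (S : Set G) (x y : G), x - y ∈ (⊥ : AddSubgroup G) → y ∈ S → x ∈ S := by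
    intro S x y hxy hy
    rw [AddSubgroup.mem_bot, sub_eq_zero] at hxy
    rwa [hxy]
  have h := D.le_dim_of_fibers M _ _ (c.cosetClass ⊥ '' {x | x - a ∈ H})
    (c.cosetClass ⊥ '' (H : Set G)) (c.translate ⊥ (-a)) 0
    (isInterpretable_image_cosetClass hc hb (hinv _) (hH.coset hc a))
    (isInterpretable_image_cosetClass hc hb (hinv _) hH)
    (isInterpretableMap_translate hc hb (hH.coset hc a) (fun x hx => by
      simpa [sub_eq_add_neg] using hx)) ?_
  · simpa using h
  · rintro _ ⟨y, hy, rfl⟩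
    have : c.cosetClass ⊥ '' {x | x - a ∈ H} ∩ c.translate ⊥ (-a) ⁻¹' {c.cosetClass ⊥ y} =
        c.cosetClass ⊥ '' {x | x - (y + a) ∈ (⊥ : AddSubgroup G)} := by
      ext q
      constructor
      · rintro ⟨⟨x, hx, rfl⟩, h⟩
        refine ⟨x, ?_, rfl⟩
        rw [Set.mem_preimage, Set.mem_singleton_iff, translate_cosetClass] at h
        have := cosetClass_bot_injective h
        simp [← this]
      · rintro ⟨x, hx, rfl⟩
        rw [Set.mem_ofPred_eq, AddSubgroup.mem_bot, sub_eq_zero] at hx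
        subst hx
        refine ⟨⟨_, by simpa using hy, rfl⟩, ?_⟩
        simp [translate_cosetClass]
    rw [this]
    exact D.dim_nonneg_image_cosetClass hc hb (hinv _) (hb.coset hc _) (a := y + a) (by simp)

/-- A definable subgroup of infinite index has smaller dimension. -/
theorem dim_lt_of_relIndex_eq_zero (hc : c.IsDefinableAddGroup L) {H K : AddSubgroup G}
    (hH : c.IsDefinable L (H : Set G)) (hK : c.IsDefinable L (K : Set G)) (hHK : H ≤ K)
    (h0 : H.relIndex K = 0) {n : ℕ}
    (hn : D.dim M (c.cosetSetoid ⊥) (c.cosetClass ⊥ '' (H : Set G)) = n) :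
    D.dim M (c.cosetSetoid ⊥) (c.cosetClass ⊥ '' (H : Set G)) <
      D.dim M (c.cosetSetoid ⊥) (c.cosetClass ⊥ '' (K : Set G)) := by
  have hb := isDefinable_bot (L := L) hc
  have hinv : ∀ (S : Set G) (x y : G), x - y ∈ (⊥ : AddSubgroup G) → y ∈ S → x ∈ S := by
    intro S x y hxy hy
    rw [AddSubgroup.mem_bot, sub_eq_zero] at hxy
    rwa [hxy]
  have hinvK : ∀ x y, x - y ∈ H → y ∈ (K : Set G) → x ∈ (K : Set G) := fun x y hxy hy => by
    simpa using K.add_mem (hHK hxy) hy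
  have hY := isInterpretable_image_cosetClass hc hH hinvK hK
  have h := D.le_dim_of_fibers M _ _ (c.cosetClass ⊥ '' (K : Set G))
    (c.cosetClass H '' (K : Set G)) (c.translate H 0) n
    (isInterpretable_image_cosetClass hc hb (hinv _) hK) hY
    (isInterpretableMap_translate hc hH hK (fun x hx => by simpa using hx)) ?_
  · have hpos := D.dim_nonneg_image_cosetClass hc hH hinvK hK (a := 0) K.zero_mem
    have hne : D.dim M (c.cosetSetoid H) (c.cosetClass H '' (K : Set G)) ≠ 0 := by
      rw [Ne, D.dim_eq_zero_iff M _ _ hY ⟨_, 0, K.zero_mem, rfl⟩]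
      intro hfin
      have : Finite (c.cosetClass H '' (K : Set G)) := hfin
      have : Finite (K ⧸ H.addSubgroupOf K) := by
        refine Finite.of_injective (β := c.cosetClass H '' (K : Set G))
          (fun q => ⟨c.cosetClass H (q.out : G), _, q.out.2, rfl⟩) fun q r hqr => ?_
        replace hqr := cosetClass_eq_iff.mp (congrArg Subtype.val hqr)
        rw [← QuotientAddGroup.out_eq' q, ← QuotientAddGroup.out_eq' r, QuotientAddGroup.eq,
          AddSubgroup.mem_addSubgroupOf]
        simpa [sub_eq_neg_add] using hqr
      exact AddSubgroup.index_ne_zero_of_finite (H := H.addSubgroupOf K) h0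
    -- Now `dim (K/H)` is neither `⊥` nor 0, so it is at least 1 and `dim K ≥ n + 1`.
    rw [hn] at *
    generalize D.dim M (c.cosetSetoid H) (c.cosetClass H '' (K : Set G)) = d at *
    generalize D.dim M (c.cosetSetoid ⊥) (c.cosetClass ⊥ '' (K : Set G)) = e at *
    induction d with
    | bot => simp at hpos
    | coe d =>
      refine lt_of_lt_of_le ?_ h
      have hd : d ≠ 0 := by simpa using hne
      rw [← WithBot.coe_natCast, ← WithBot.coe_add]
      simp only [Nat.cast_id, WithBot.coe_lt_coe]
      omega
  · rintro _ ⟨y, hy, rfl⟩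
    have : c.cosetClass ⊥ '' (K : Set G) ∩ c.translate H 0 ⁻¹' {c.cosetClass H y} =
        c.cosetClass ⊥ '' {x | x - y ∈ H} := by
      ext q
      constructor
      · rintro ⟨⟨x, hx, rfl⟩, h⟩
        refine ⟨x, ?_, rfl⟩
        rwa [Set.mem_preimage, Set.mem_singleton_iff, translate_cosetClass, add_zero, eq_comm,
          cosetClass_eq_iff] at h
      · rintro ⟨x, hx, rfl⟩
        refine ⟨⟨_, hinvK x y hx hy, rfl⟩, ?_⟩
        rwa [Set.mem_preimage, Set.mem_singleton_iff, translate_cosetClass, add_zero, eq_comm,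
          cosetClass_eq_iff]
    rw [this, ← hn]
    exact D.dim_subgroup_le_dim_coset hc hH y

include D in
/-- The definable subgroups carry a rank that drops at subgroups of infinite index. -/
theorem exists_rank (hc : c.IsDefinableAddGroup L) :
    ∃ δ : AddSubgroup G → ℕ, ∀ H K : AddSubgroup G, c.IsDefinable L (H : Set G) →
      c.IsDefinable L (K : Set G) → H ≤ K → H.relIndex K = 0 → δ H < δ K := by
  have hb := isDefinable_bot (L := L) hc
  have key : ∀ H : AddSubgroup G, c.IsDefinable L (H : Set G) →
      ∃ n : ℕ, D.dim M (c.cosetSetoid ⊥) (c.cosetClass ⊥ '' (H : Set G)) = n := by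
    intro H hH
    have := D.dim_nonneg_image_cosetClass hc hb (S := (H : Set G)) (fun x y hxy hy => by
      rw [AddSubgroup.mem_bot, sub_eq_zero] at hxy; rwa [hxy]) hH (a := 0) H.zero_mem
    generalize D.dim M (c.cosetSetoid ⊥) (c.cosetClass ⊥ '' (H : Set G)) = d at *
    induction d with
    | bot => simp at this
    | coe d => exact ⟨d, rfl⟩
  -- The default value 0 is never used at a definable subgroup: it is nonempty, so its dimension is
  -- not `⊥`.
  refine ⟨fun H => (D.dim M (c.cosetSetoid ⊥) (c.cosetClass ⊥ '' (H : Set G))).unbotD 0, ?_⟩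
  intro H K hH hK hHK h0
  obtain ⟨n, hn⟩ := key H hH
  obtain ⟨m, hm⟩ := key K hK
  have := D.dim_lt_of_relIndex_eq_zero hc hH hK hHK h0 hn
  simp only [hn, hm] at this ⊢
  simpa using this

end TheoryDimension

/-! ### Counting incongruent elements -/

/-- `K` contains `k` elements that are pairwise incongruent modulo `H`. -/
def AddSubgroup.HasIncongruent {G : Type*} [AddCommGroup G] (H K : AddSubgroup G) (k : ℕ) : Prop :=
  ∃ y : Fin k → G, (∀ s, y s ∈ K) ∧ ∀ s t, s ≠ t → y s - y t ∉ H

/-- Infinite index is encoded as `relIndex = 0`, whence the two cases. Unlike the index itself, the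
left side for fixed `k` is expressible by a first-order formula and passes to ultrapowers. -/
theorem AddSubgroup.hasIncongruent_iff {G : Type*} [AddCommGroup G] {H K : AddSubgroup G} {k : ℕ} :
    H.HasIncongruent K k ↔ H.relIndex K = 0 ∨ k ≤ H.relIndex K := by
  have hmk : ∀ x y : K, (QuotientAddGroup.mk x : K ⧸ H.addSubgroupOf K) = QuotientAddGroup.mk y ↔
      (y : G) - x ∈ H := fun x y => by
    rw [QuotientAddGroup.eq, AddSubgroup.mem_addSubgroupOf]
    simp [sub_eq_neg_add]
  have hemb : H.HasIncongruent K k ↔ Nonempty (Fin k ↪ K ⧸ H.addSubgroupOf K) := by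
    constructor
    · rintro ⟨y, hy, hyH⟩
      refine ⟨⟨fun s => QuotientAddGroup.mk ⟨y s, hy s⟩, fun s t hst => ?_⟩⟩
      by_contra hne
      exact hyH t s (Ne.symm hne) ((hmk _ _).mp hst)
    · rintro ⟨f⟩
      refine ⟨fun s => ((f s).out : K), fun s => (f s).out.2, fun s t hst h => hst ?_⟩
      rw [← hmk, QuotientAddGroup.out_eq', QuotientAddGroup.out_eq'] at h
      exact (f.injective h).symm
  rw [hemb]
  have hcard : H.relIndex K = Nat.card (K ⧸ H.addSubgroupOf K) := rfl
  rcases finite_or_infinite (K ⧸ H.addSubgroupOf K) with h | h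
  · have := Fintype.ofFinite (K ⧸ H.addSubgroupOf K)
    have hpos : Nat.card (K ⧸ H.addSubgroupOf K) ≠ 0 := Nat.card_pos.ne'
    rw [hcard, or_iff_right hpos, Nat.card_eq_fintype_card]
    constructor
    · rintro ⟨f⟩
      simpa using Fintype.card_le_of_embedding f
    · exact fun h => Function.Embedding.nonempty_of_card_le (by simpa using h)
  · rw [hcard, Nat.card_eq_zero_of_infinite]
    simpa using ⟨Fin.valEmbedding.trans (Infinite.natEmbedding _)⟩

/-! ### Ultrapowers -/

open Filter

namespace Coordinates

variable {L : FirstOrder.Language.{u, v}} {M : Type w} [L.Structure M] [Nonempty M]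

/-- The ultrapower of `M` over `ℕ`. -/
abbrev Ultrapower (M : Type w) : Type w := ((hyperfilter ℕ : Ultrafilter ℕ) : Filter ℕ).Product fun _ => M

/-- A sequence of representatives of an element of the ultrapower. -/
noncomputable def Ultrapower.rep (x : Ultrapower M) : ℕ → M := Quotient.out x

omit [Nonempty M] in
theorem Ultrapower.coe_rep (x : Ultrapower M) :
    ((x.rep : ∀ _ : ℕ, M) : Ultrapower M) = x := Quotient.out_eq x

omit [Nonempty M] in
theorem Ultrapower.rep_coe (f : ℕ → M) :
    ∀ᶠ k in (hyperfilter ℕ : Filter ℕ), Ultrapower.rep (f : Ultrapower M) k = f k :=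
  Quotient.exact (Ultrapower.coe_rep (f : Ultrapower M))

theorem ultrapower_models (T : L.Theory) [M ⊨ T] : Ultrapower M ⊨ T := by
  refine ⟨fun φ hφ => ?_⟩
  rw [Language.Ultraproduct.sentence_realize]
  exact Eventually.of_forall fun _ => Language.Theory.realize_sentence_of_mem T hφ

/-- The internal set given by a sequence of members of a definable family is definable. -/
theorem definableIn_internal {α β : Type*} {P : Set (α ⊕ β → M)} (hP : DefinableIn L P)
    (b : ℕ → β → M) :
    DefinableIn L {x : α → Ultrapower M |
      ∀ᶠ k in (hyperfilter ℕ : Filter ℕ), Sum.elim (fun i => (x i).rep k) (b k) ∈ P} := by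
  obtain ⟨φ, rfl⟩ := Set.definable_iff_exists_formula_sum.mp hP
  -- The same formula defines the internal set: old parameters become constant sequences, and the
  -- varying parameters `b k` become their germ. Łoś's theorem does the rest.
  refine Set.definable_iff_exists_formula_sum.mpr ⟨φ.relabel
    (Sum.elim (fun m => Sum.inl ⟨((fun _ => m.1 : ∀ _ : ℕ, M) : Ultrapower M), Set.mem_univ _⟩)
      (Sum.elim Sum.inr fun j => Sum.inl ⟨((fun k => b k j : ∀ _ : ℕ, M) : Ultrapower M),
        Set.mem_univ _⟩)), ?_⟩
  ext x
  rw [Set.mem_ofPred_eq, Set.mem_ofPred_eq, Language.Formula.realize_relabel]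
  let t : (↑(Set.univ : Set M) ⊕ (α ⊕ β)) → ∀ _ : ℕ, M :=
    Sum.elim (fun m _ => m.1) (Sum.elim (fun i => (x i).rep) fun j k => b k j)
  have ht := Language.Ultraproduct.realize_formula_cast (u := hyperfilter ℕ) φ t
  have h1 : (fun i => ((t i : ∀ _ : ℕ, M) : Ultrapower M)) =
      Sum.elim (fun m : ↑(Set.univ : Set (Ultrapower M)) => m.1) x ∘
      (Sum.elim (fun m => Sum.inl ⟨((fun _ => m.1 : ∀ _ : ℕ, M) : Ultrapower M), Set.mem_univ _⟩)
      (Sum.elim Sum.inr fun j => Sum.inl ⟨((fun k => b k j : ∀ _ : ℕ, M) : Ultrapower M),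
        Set.mem_univ _⟩)) := by
    funext i
    rcases i with m | i | j
    · rfl
    · exact Ultrapower.coe_rep (x i)
    · rfl
  rw [← h1]
  have h2 : ∀ k, (fun i => t i k) =
      Sum.elim (fun m : ↑(Set.univ : Set M) => m.1)
        (Sum.elim (fun i => (x i).rep k) (b k)) := by
    intro k
    funext i
    rcases i with m | i | j <;> rfl
  refine Iff.trans ?_ ht.symm
  simp only [h2, Set.mem_ofPred_eq]

theorem definableIn_ultrapower {α : Type*} {P : (α → M) → Prop} (hP : DefinableIn L {y | P y}) :
    DefinableIn L {x : α → Ultrapower M |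
      ∀ᶠ k in (hyperfilter ℕ : Filter ℕ), P fun i => (x i).rep k} :=
  definableIn_internal (β := Empty) (P := {y | P (y ∘ Sum.inl)})
    (Set.Definable.preimage_comp Sum.inl hP) fun _ => Empty.elim

variable {G : Type z}

/-- Coordinates for the ultrapower of `G` in the ultrapower of `M`. -/
noncomputable def ultrapower (c : Coordinates M G) :
    Coordinates (Ultrapower M) (Germ (hyperfilter ℕ : Filter ℕ) G) where
  arity := c.arity
  carrier := {x | ∀ᶠ k in (hyperfilter ℕ : Filter ℕ), (fun i => (x i).rep k) ∈ c.carrier}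
  toFun x := ((fun k => c.toFun fun i => (x i).rep k : ℕ → G) : Germ (hyperfilter ℕ : Filter ℕ) G)
  surjOn := by
    intro g _
    induction g using Germ.inductionOn with
    | _ f =>
      choose r hr hrf using fun k => c.surjOn (Set.mem_univ (f k))
      have h : ∀ᶠ k in (hyperfilter ℕ : Filter ℕ), ∀ i,
          Ultrapower.rep ((fun k => r k i : ∀ _ : ℕ, M) : Ultrapower M) k = r k i :=
        eventually_all.mpr fun i => Ultrapower.rep_coe fun k => r k i
      refine ⟨fun i => ((fun k => r k i : ∀ _ : ℕ, M) : Ultrapower M), ?_, ?_⟩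
      · filter_upwards [h] with k hk
        simpa only [hk] using hr k
      · refine Germ.coe_eq.mpr ?_
        filter_upwards [h] with k hk
        simp only [hk]
        exact hrf k

variable {c : Coordinates M G}

theorem IsDefinableAddGroup.ultrapower [AddCommGroup G] (hc : c.IsDefinableAddGroup L) :
    c.ultrapower.IsDefinableAddGroup L where
  carrier_definable := definableIn_ultrapower (P := (· ∈ c.carrier)) hc.carrier_definable
  eq_definable := by
    refine (congrArg (DefinableIn L) ?_).mp (definableIn_ultrapower hc.eq_definable)
    ext p
    simp only [Set.mem_ofPred_eq, eventually_and]
    exact and_congr_right fun _ => and_congr_right fun _ => Germ.coe_eq.symm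
  add_definable := by
    refine (congrArg (DefinableIn L) ?_).mp (definableIn_ultrapower hc.add_definable)
    ext p
    simp only [Set.mem_ofPred_eq, eventually_and]
    exact and_congr_right fun _ => and_congr_right fun _ => and_congr_right fun _ => Germ.coe_eq.symm

/-- The subgroup of the ultrapower given by a sequence of subgroups. -/
def internalSubgroup [AddCommGroup G] (S : ℕ → AddSubgroup G) :
    AddSubgroup (Germ (hyperfilter ℕ : Filter ℕ) G) where
  carrier := {g | ∃ f : ℕ → G, (f : Germ (hyperfilter ℕ : Filter ℕ) G) = g ∧
    ∀ᶠ k in (hyperfilter ℕ : Filter ℕ), f k ∈ S k}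
  zero_mem' := ⟨0, rfl, Eventually.of_forall fun k => (S k).zero_mem⟩
  add_mem' := by
    rintro _ _ ⟨f, rfl, hf⟩ ⟨g, rfl, hg⟩
    refine ⟨f + g, rfl, ?_⟩
    filter_upwards [hf, hg] with k h1 h2 using (S k).add_mem h1 h2
  neg_mem' := by
    rintro _ ⟨f, rfl, hf⟩
    refine ⟨-f, rfl, ?_⟩
    filter_upwards [hf] with k h1 using (S k).neg_mem h1

omit [L.Structure M] [Nonempty M] in
theorem coe_mem_internalSubgroup [AddCommGroup G] {S : ℕ → AddSubgroup G} {f : ℕ → G} :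
    (f : Germ (hyperfilter ℕ : Filter ℕ) G) ∈ internalSubgroup S ↔
      ∀ᶠ k in (hyperfilter ℕ : Filter ℕ), f k ∈ S k := by
  constructor
  · rintro ⟨g, hg, h⟩
    filter_upwards [Germ.coe_eq.mp hg, h] with k h1 h2
    rwa [← h1]
  · exact fun h => ⟨f, rfl, h⟩

omit [L.Structure M] [Nonempty M] in
theorem internalSubgroup_inf [AddCommGroup G] (S S' : ℕ → AddSubgroup G) :
    internalSubgroup (fun k => S k ⊓ S' k) = internalSubgroup S ⊓ internalSubgroup S' := by
  ext g
  induction g using Germ.inductionOn with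
  | _ f => simp only [AddSubgroup.mem_inf, coe_mem_internalSubgroup, eventually_and]

omit [L.Structure M] [Nonempty M] in
-- For fixed `n`, almost every stage `k` supplies `n` incongruent elements, and their germs stay
-- incongruent. As `n` is arbitrary, the index is infinite.
theorem relIndex_internalSubgroup_eq_zero [AddCommGroup G] {S S' : ℕ → AddSubgroup G}
    (h : ∀ k, (S' k).HasIncongruent (S k) k) :
    (internalSubgroup S').relIndex (internalSubgroup S) = 0 := by
  by_contra hne
  have hkey : (internalSubgroup S').HasIncongruent (internalSubgroup S)
      ((internalSubgroup S').relIndex (internalSubgroup S) + 1) := by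
    generalize (internalSubgroup S').relIndex (internalSubgroup S) + 1 = n
    have h' : ∀ k, ∃ y : Fin n → G, n ≤ k →
        (∀ s, y s ∈ S k) ∧ ∀ s t, s ≠ t → y s - y t ∉ S' k := by
      intro k
      by_cases hk : n ≤ k
      · obtain ⟨y, h1, h2⟩ := h k
        exact ⟨fun s => y (Fin.castLE hk s), fun _ => ⟨fun s => h1 _, fun s t hst => h2 _ _
          fun h => hst (Fin.castLE_injective hk h)⟩⟩
      · exact ⟨0, fun h => absurd h hk⟩
    choose y hy using h'
    have hlarge : ∀ᶠ k in (hyperfilter ℕ : Filter ℕ), n ≤ k := by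
      refine Filter.Eventually.filter_mono ?_ (eventually_ge_atTop n)
      rw [← Nat.cofinite_eq_atTop]
      exact hyperfilter_le_cofinite
    refine ⟨fun s => ((fun k => y k s : ℕ → G) : Germ (hyperfilter ℕ : Filter ℕ) G), fun s => ?_,
      fun s t hst => ?_⟩
    · rw [coe_mem_internalSubgroup]
      filter_upwards [hlarge] with k hk using (hy k hk).1 s
    · rw [← Germ.coe_sub, coe_mem_internalSubgroup, ← Ultrafilter.eventually_not]
      filter_upwards [hlarge] with k hk using (hy k hk).2 s t hst
  rw [AddSubgroup.hasIncongruent_iff] at hkey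
  omega

theorem isDefinable_internalSubgroup_const [AddCommGroup G] {K : AddSubgroup G}
    (hK : c.IsDefinable L (K : Set G)) :
    c.ultrapower.IsDefinable L (internalSubgroup (fun _ => K) : Set (Germ _ G)) := by
  refine (congrArg (DefinableIn L) ?_).mp (definableIn_ultrapower hK)
  ext x
  simp only [Set.mem_ofPred_eq, eventually_and]
  exact and_congr_right fun _ =>
    (coe_mem_internalSubgroup (S := fun _ => K)).symm

/-- All the centralisers belong to the one definable family `⁅y, x⁆ = 0`, so a single formula works
at every stage. -/
theorem isDefinable_internalSubgroup_centralizer [LieRing G] (hc : c.IsDefinableLieRing L)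
    (a : ℕ → G) :
    c.ultrapower.IsDefinable L
      (internalSubgroup (fun k => LieRing.elementCentralizer (a k)) : Set (Germ _ G)) := by
  have hA := hc.toIsDefinableAddGroup
  have h := DefRel.definableIn₂ (R := fun x y => ⁅y, x⁆ = 0)
    (hA.eq (hc.bracket (hA.proj _) (hA.proj _)) (hA.const 0))
  choose b hb hba using fun k => c.surjOn (Set.mem_univ (a k))
  refine (congrArg (DefinableIn L) ?_).mp (definableIn_internal h b)
  ext x
  simp only [Set.mem_ofPred_eq, Sum.elim_comp_inl, Sum.elim_comp_inr, eventually_and, hba, hb,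
    true_and]
  exact and_congr_right fun _ =>
    (coe_mem_internalSubgroup (S := fun k => LieRing.elementCentralizer (a k))).symm

end Coordinates

/-! ### Uniform bounds on the indices of centralisers -/

/-- If the finite indices were unbounded, then for each `m` one could cut `K` down repeatedly by
centralisers of finite index, each cut leaving at least `m` classes. Such cuts need not lower the
dimension in `M`, but in the ultraproduct over `m` every cut has infinite index, and the rank would
descend forever. -/
theorem TheoryDimension.exists_relIndex_centralizer_le {L : FirstOrder.Language.{u, v}}
    {T : L.Theory} (D : TheoryDimension.{u, v, w} T) {M : Type w} [L.Structure M] [Nonempty M]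
    [M ⊨ T] {𝔤 : Type z} [LieRing 𝔤] {c : Coordinates M 𝔤} (hc : c.IsDefinableLieRing L)
    {K : AddSubgroup 𝔤} (hK : c.IsDefinable L (K : Set 𝔤)) :
    ∃ k, ∀ x, (LieRing.elementCentralizer x).relIndex K ≠ 0 →
      (LieRing.elementCentralizer x).relIndex K ≤ k := by
  by_contra! hcon
  have hstep : ∀ (m : ℕ) (S : {S : AddSubgroup 𝔤 // S ≤ K ∧ S.relIndex K ≠ 0}), ∃ x,
      (LieRing.elementCentralizer x).relIndex K ≠ 0 ∧
      (LieRing.elementCentralizer x).HasIncongruent S.1 m := by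
    rintro m ⟨S, hSK, hS⟩
    -- Since `[K : C(x) ∩ S] = [S : C(x) ∩ S] · [K : S]`, an index above `m · [K : S]` in `K` forces
    -- one above `m` in `S`.
    obtain ⟨x, hx0, hx⟩ := hcon (m * S.relIndex K)
    refine ⟨x, hx0, AddSubgroup.hasIncongruent_iff.mpr (Or.inr ?_)⟩
    have h1 := AddSubgroup.relIndex_inf_mul_relIndex (LieRing.elementCentralizer x) S K
    rw [inf_of_le_left hSK] at h1
    have h2 : (LieRing.elementCentralizer x).relIndex K ≤
        (LieRing.elementCentralizer x ⊓ S).relIndex K :=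
      AddSubgroup.relIndex_le_of_le_left inf_le_left (AddSubgroup.relIndex_inf_ne_zero hx0 hS)
    have h3 := hx.trans_le (h2.trans_eq h1.symm)
    exact (Nat.lt_of_mul_lt_mul_right h3).le
  choose x hx0 hx using hstep
  obtain ⟨S, hS0, hS⟩ : ∃ S : ℕ → ℕ → {S : AddSubgroup 𝔤 // S ≤ K ∧ S.relIndex K ≠ 0},
      (∀ m, (S m 0).1 = K) ∧
        ∀ m i, (S m (i + 1)).1 = (S m i).1 ⊓ LieRing.elementCentralizer (x m (S m i)) :=
    ⟨fun m i => Nat.rec ⟨K, le_rfl, by simp⟩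
      (fun _ S => ⟨S.1 ⊓ LieRing.elementCentralizer (x m S), inf_le_left.trans S.2.1,
        AddSubgroup.relIndex_inf_ne_zero S.2.2 (hx0 m S)⟩) i, fun _ => rfl, fun _ _ => rfl⟩
  obtain ⟨I, hI⟩ : ∃ I : ℕ → AddSubgroup (Germ (hyperfilter ℕ : Filter ℕ) 𝔤),
      ∀ i, I i = Coordinates.internalSubgroup fun m => (S m i).1 := ⟨_, fun _ => rfl⟩
  have hI' : ∀ i, I (i + 1) = I i ⊓ Coordinates.internalSubgroup
      (fun m => LieRing.elementCentralizer (x m (S m i))) := fun i => by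
    simp only [hI, hS, Coordinates.internalSubgroup_inf]
  have hdef : ∀ i, c.ultrapower.IsDefinable L (I i : Set (Germ _ 𝔤)) := by
    intro i
    induction i with
    | zero =>
      simp only [hI, hS0]
      exact Coordinates.isDefinable_internalSubgroup_const hK
    | succ i ih =>
      rw [hI']
      exact ih.inter (Coordinates.isDefinable_internalSubgroup_centralizer hc _)
  have : Coordinates.Ultrapower M ⊨ T := Coordinates.ultrapower_models T
  obtain ⟨δ, hδ⟩ := D.exists_rank (M := Coordinates.Ultrapower M)
    hc.toIsDefinableAddGroup.ultrapower
  have hlt : ∀ i, δ (I (i + 1)) < δ (I i) := fun i => by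
    refine hδ _ _ (hdef _) (hdef _) ?_ ?_
    · rw [hI']
      exact inf_le_left
    · rw [hI', inf_comm, AddSubgroup.inf_relIndex_right, hI]
      exact Coordinates.relIndex_internalSubgroup_eq_zero fun m => hx m (S m i)
  obtain ⟨i, hi⟩ := WellFounded.not_rel_apply_succ (r := (· < ·)) fun i => δ (I i)
  exact hi (hlt i)

/-! ### Almost centralisers -/

namespace LieRing

variable {𝔤 : Type z} [LieRing 𝔤]

theorem mem_elementCentralizer {x y : 𝔤} : y ∈ elementCentralizer x ↔ ⁅x, y⁆ = 0 := Iff.rfl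

theorem mem_elementCentralizer_comm {x y : 𝔤} :
    y ∈ elementCentralizer x ↔ x ∈ elementCentralizer y := by
  rw [mem_elementCentralizer, mem_elementCentralizer, ← lie_skew, neg_eq_zero]

/-- The map `y ↦ ⁅x, y⁆` as a homomorphism of additive groups. -/
def adHom (x : 𝔤) : 𝔤 →+ 𝔤 := (LieAlgebra.ad ℤ 𝔤 x).toAddMonoidHom

theorem adHom_apply (x y : 𝔤) : adHom x y = ⁅x, y⁆ := rfl

theorem elementCentralizer_eq_comap (x : 𝔤) : elementCentralizer x = (⊥ : AddSubgroup 𝔤).comap (adHom x) := rfl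

/-- The elements whose centraliser has finite index in `K`. -/
def almostCentralizer (K : AddSubgroup 𝔤) : AddSubgroup 𝔤 where
  carrier := {x | (elementCentralizer x).relIndex K ≠ 0}
  zero_mem' := by
    have h : elementCentralizer (0 : 𝔤) = ⊤ := by
      ext y
      simp [elementCentralizer]
    simp [h]
  add_mem' := by
    intro a b ha hb h
    refine AddSubgroup.relIndex_inf_ne_zero ha hb (AddSubgroup.relIndex_eq_zero_of_le_left ?_ h)
    rintro y ⟨h1, h2⟩
    change ⁅a, y⁆ = 0 at h1
    change ⁅b, y⁆ = 0 at h2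
    change ⁅a + b, y⁆ = 0
    rw [add_lie, h1, h2, add_zero]
  neg_mem' := by
    intro a ha
    have h : elementCentralizer (-a) = elementCentralizer a := by
      ext y
      rw [mem_elementCentralizer, mem_elementCentralizer, neg_lie, neg_eq_zero]
    rwa [Set.mem_ofPred_eq, h]

theorem mem_almostCentralizer {K : AddSubgroup 𝔤} {x : 𝔤} :
    x ∈ almostCentralizer K ↔ (elementCentralizer x).relIndex K ≠ 0 := Iff.rfl

theorem almostCentralizer_top :
    almostCentralizer (⊤ : AddSubgroup 𝔤) = (almostCenter 𝔤).toSubmodule.toAddSubgroup := by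
  ext x
  rw [mem_almostCentralizer, AddSubgroup.relIndex_top_right, ← AddSubgroup.finiteIndex_iff]
  rfl

theorem almostCentralizer_anti {K K' : AddSubgroup 𝔤} (h : K ≤ K') :
    almostCentralizer K' ≤ almostCentralizer K := fun _ hx h0 =>
  hx (AddSubgroup.relIndex_eq_zero_of_le_right h h0)

/-- The almost centraliser of a subgroup that is invariant up to finite index is an ideal. -/
def almostCentralizerIdeal (K : AddSubgroup 𝔤) (hK : ∀ g, (K.comap (adHom g)).relIndex K ≠ 0) :
    LieIdeal ℤ 𝔤 where
  toSubmodule := AddSubgroup.toIntSubmodule (almostCentralizer K)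
  lie_mem := by
    intro g x hx h
    change (elementCentralizer x).relIndex K ≠ 0 at hx
    -- By the Jacobi identity `C([g,x])` contains every `y ∈ C(x)` with `[g,y] ∈ C(x)`. The second
    -- condition has finite index in `K`, because `[g,y] ∈ K` for `y` in a subgroup of finite index.
    have h1 : ((elementCentralizer x).comap (adHom g)).relIndex K ≠ 0 := by
      refine AddSubgroup.relIndex_ne_zero_trans (K := K.comap (adHom g) ⊓ K) ?_ ?_
      · rw [AddSubgroup.relIndex_comap]
        refine fun h0 => hx (AddSubgroup.relIndex_eq_zero_of_le_right ?_ h0)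
        rintro _ ⟨y, hy, rfl⟩
        exact hy.1
      · rw [AddSubgroup.inf_relIndex_right]
        exact hK g
    refine AddSubgroup.relIndex_inf_ne_zero hx h1 (AddSubgroup.relIndex_eq_zero_of_le_left ?_ h)
    rintro y ⟨h2, h3⟩
    change ⁅x, y⁆ = 0 at h2
    change ⁅x, ⁅g, y⁆⁆ = 0 at h3
    change ⁅⁅g, x⁆, y⁆ = 0
    rw [lie_lie, h2, h3, lie_zero, sub_zero]

theorem relIndex_comap_adHom_ideal (A : LieIdeal ℤ 𝔤) (g : 𝔤) :
    (A.toSubmodule.toAddSubgroup.comap (adHom g)).relIndex A.toSubmodule.toAddSubgroup ≠ 0 := by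
  rw [AddSubgroup.relIndex_eq_one.mpr]
  · exact one_ne_zero
  · exact fun y hy => A.lie_mem hy

/-- A group is not covered by finitely many subgroups of infinite index. -/
theorem exists_mem_forall_notMem {G : Type*} [AddCommGroup G] {ι : Type*} [Finite ι]
    (A : AddSubgroup G) (H : ι → AddSubgroup G) (hH : ∀ i, (H i).relIndex A = 0) :
    ∃ x ∈ A, ∀ i, x ∉ H i := by
  have := Fintype.ofFinite ι
  by_contra! hcon
  obtain ⟨i, -, hi⟩ := AddSubgroup.exists_finiteIndex_of_leftCoset_cover
    (s := (Finset.univ : Finset ι)) (g := fun _ => (0 : A)) (H := fun i => (H i).addSubgroupOf A) (by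
      refine Set.eq_univ_of_forall fun x => ?_
      obtain ⟨i, hi⟩ := hcon x x.2
      refine Set.mem_iUnion₂.mpr ⟨i, Finset.mem_univ i, x, hi, ?_⟩
      simp)
  exact hi.index_ne_zero (hH i)

/-- Symmetry of almost centralisation. -/
theorem relIndex_almostCentralizer_ne_zero {A K : AddSubgroup 𝔤} {k : ℕ}
    (h0 : A ≤ almostCentralizer K) (h : ∀ x ∈ A, (elementCentralizer x).relIndex K ≤ k) :
    (almostCentralizer A).relIndex K ≠ 0 := by
  intro hcon
  -- The centralisers of the differences of these `k + 1` elements have infinite index in `A`, so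
  -- some `x ∈ A` avoids them all. The `k + 1` elements are then incongruent modulo `C(x)`, against
  -- the bound.
  obtain ⟨y, hy, hyA⟩ := AddSubgroup.hasIncongruent_iff (k := k + 1).mpr (Or.inl hcon)
  obtain ⟨x, hx, hxy⟩ := exists_mem_forall_notMem A
    (fun p : {p : Fin (k + 1) × Fin (k + 1) // p.1 ≠ p.2} =>
      elementCentralizer (y p.1.1 - y p.1.2)) fun p => by
        simpa [mem_almostCentralizer] using hyA _ _ p.2
  have h1 : (elementCentralizer x).HasIncongruent K (k + 1) :=
    ⟨y, hy, fun s t hst hmem => hxy ⟨(s, t), hst⟩ (mem_elementCentralizer_comm.mp hmem)⟩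
  rw [AddSubgroup.hasIncongruent_iff] at h1
  have := h x hx
  rcases h1 with h1 | h1
  · exact h0 hx h1
  · omega

end LieRing

/-! ### Neumann's theorem on the derived ideal -/

/-- Subgroups generated by finitely many finite subgroups are finite. -/
theorem AddSubgroup.bot_relIndex_iSup_ne_zero {G : Type*} [AddCommGroup G] {ι : Type*} [Finite ι]
    {H : ι → AddSubgroup G} (hH : ∀ i, (⊥ : AddSubgroup G).relIndex (H i) ≠ 0) :
    (⊥ : AddSubgroup G).relIndex (⨆ i, H i) ≠ 0 := by
  have := Fintype.ofFinite ι
  rw [← Finset.sup_univ_eq_iSup]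
  refine Finset.sup_induction (p := fun K => (⊥ : AddSubgroup G).relIndex K ≠ 0) (by simp) ?_
    fun i _ => hH i
  intro K hK K' hK'
  refine AddSubgroup.relIndex_ne_zero_trans (K := K) hK ?_
  rw [AddSubgroup.relIndex_sup_left]
  exact fun h => hK' (AddSubgroup.relIndex_eq_zero_of_le_left bot_le h)

namespace LieRing

variable {𝔤 : Type z} [LieRing 𝔤]

theorem relIndex_elementCentralizer (x : 𝔤) (K : AddSubgroup 𝔤) :
    (elementCentralizer x).relIndex K = Nat.card (K.map (adHom x)) := by
  rw [elementCentralizer_eq_comap, AddSubgroup.relIndex_comap, AddSubgroup.relIndex_bot_left]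

/-- Neumann's theorem: if the centralisers in an ideal of its elements have bounded index in it, then
its derived ideal is finite. -/
theorem finite_lie_self {B : LieIdeal ℤ 𝔤} {k : ℕ}
    (hB : B.toSubmodule.toAddSubgroup ≤ almostCentralizer B.toSubmodule.toAddSubgroup)
    (hk : ∀ x ∈ B, (elementCentralizer x).relIndex B.toSubmodule.toAddSubgroup ≤ k) :
    Finite (⁅B, B⁆ : LieIdeal ℤ 𝔤) := by
  set B' := B.toSubmodule.toAddSubgroup with hB'
  -- Choose `x ∈ B` for which `[x,B]` has the largest possible size.
  obtain ⟨x, hx⟩ : sSup (Set.range fun x : B => (elementCentralizer (x : 𝔤)).relIndex B') ∈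
      Set.range fun x : B => (elementCentralizer (x : 𝔤)).relIndex B' :=
    Nat.sSup_mem (Set.range_nonempty _) ⟨k, by rintro _ ⟨x, rfl⟩; exact hk x x.2⟩
  have hmax : ∀ x' ∈ B, (elementCentralizer x').relIndex B' ≤ (elementCentralizer (x : 𝔤)).relIndex B' := by
    intro x' hx'
    refine le_of_le_of_eq ?_ hx.symm
    exact le_csSup ⟨k, by rintro _ ⟨x, rfl⟩; exact hk x x.2⟩ ⟨⟨x', hx'⟩, rfl⟩
  have hfin : ∀ x' ∈ B, Finite (B'.map (adHom x')) := fun x' hx' => by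
    refine Nat.finite_of_card_ne_zero ?_
    rw [← relIndex_elementCentralizer]
    exact hB hx'
  set V := B'.map (adHom (x : 𝔤)) with hV
  have hVfin : Finite V := hfin x x.2
  choose y hyB hy using fun v : V => v.2
  let B₀ : AddSubgroup 𝔤 := ⨅ v : V, elementCentralizer (y v)
  have hB₀ : B₀.relIndex B' ≠ 0 := AddSubgroup.relIndex_iInf_ne_zero fun v => hB (hyB v)
  -- Adding `x'` does not change the brackets with the `y v`, so `V ⊆ [x + x', B]`, and maximality
  -- gives equality. Hence `[x', B] ⊆ V`.
  have hBV : ∀ x' ∈ B₀, x' ∈ B → ∀ b ∈ B, ⁅x', b⁆ ∈ V := by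
    intro x' hx' hx'B b hb
    have hle : V ≤ B'.map (adHom (x + x' : 𝔤)) := by
      intro v hv
      refine ⟨y ⟨v, hv⟩, hyB _, ?_⟩
      have h1 : ⁅x', y ⟨v, hv⟩⁆ = 0 :=
        mem_elementCentralizer_comm.mp ((AddSubgroup.mem_iInf.mp hx') ⟨v, hv⟩)
      rw [adHom_apply, add_lie, h1, add_zero]
      exact hy ⟨v, hv⟩
    have := hfin _ (B.add_mem x.2 hx'B)
    have heq : V = B'.map (adHom (x + x' : 𝔤)) := by
      refine AddSubgroup.eq_of_le_of_card_ge hle ?_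
      rw [hV, ← relIndex_elementCentralizer, ← relIndex_elementCentralizer]
      exact hmax _ (B.add_mem x.2 hx'B)
    have h1 : ⁅(x : 𝔤) + x', b⁆ ∈ V := heq ▸ ⟨b, hb, rfl⟩
    have h2 : ⁅(x : 𝔤), b⁆ ∈ V := ⟨b, hb, rfl⟩
    simpa using V.sub_mem h1 h2
  have hQ : Finite (B' ⧸ B₀.addSubgroupOf B') :=
    @AddSubgroup.finite_quotient_of_finiteIndex _ _ (B₀.addSubgroupOf B') ⟨hB₀⟩
  -- `W` is generated by `V`, which covers brackets with `B₀ ∩ B`, and by `[q, B]` for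
  -- representatives `q` of the finitely many cosets.
  let W : AddSubgroup 𝔤 := ⨆ o : Option (B' ⧸ B₀.addSubgroupOf B'),
    o.elim V fun q => B'.map (adHom (q.out : 𝔤))
  have hW : (⊥ : AddSubgroup 𝔤).relIndex W ≠ 0 := by
    refine AddSubgroup.bot_relIndex_iSup_ne_zero fun o => ?_
    rw [AddSubgroup.relIndex_bot_left]
    rcases o with _ | q
    · exact (Nat.card_pos (α := V)).ne'
    · have := hfin (q.out : 𝔤) q.out.2
      exact (Nat.card_pos (α := B'.map (adHom (q.out : 𝔤)))).ne'
  have hWfin : Finite W := by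
    rw [AddSubgroup.relIndex_bot_left] at hW
    exact Nat.finite_of_card_ne_zero hW
  have hVW : V ≤ W := le_iSup (fun o : Option (B' ⧸ B₀.addSubgroupOf B') =>
    o.elim V fun q => B'.map (adHom (q.out : 𝔤))) none
  have hqW : ∀ q : B' ⧸ B₀.addSubgroupOf B', B'.map (adHom (q.out : 𝔤)) ≤ W := fun q =>
    le_iSup (fun o : Option (B' ⧸ B₀.addSubgroupOf B') =>
      o.elim V fun q => B'.map (adHom (q.out : 𝔤))) (some q)
  have hle : (⁅B, B⁆ : LieIdeal ℤ 𝔤).toSubmodule ≤ AddSubgroup.toIntSubmodule W := by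
    rw [LieSubmodule.lieIdeal_oper_eq_linear_span', Submodule.span_le]
    rintro _ ⟨a, ha, b, hb, rfl⟩
    let q : B' ⧸ B₀.addSubgroupOf B' := QuotientAddGroup.mk ⟨a, ha⟩
    have h1 : -(q.out : 𝔤) + a ∈ B₀ := AddSubgroup.mem_addSubgroupOf.mp
      (QuotientAddGroup.eq.mp (QuotientAddGroup.out_eq' q))
    have h2 : ⁅(q.out : 𝔤), b⁆ ∈ W := hqW q ⟨b, hb, rfl⟩
    have h3 : ⁅-(q.out : 𝔤) + a, b⁆ ∈ W :=
      hVW (hBV _ h1 (B.add_mem (B.neg_mem q.out.2) ha) b hb)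
    have h4 := W.add_mem h2 h3
    rwa [← add_lie, add_neg_cancel_left] at h4
  exact Finite.of_injective (β := W) (fun x => ⟨x.1, hle x.2⟩) fun x y hxy =>
    Subtype.ext (Subtype.mk.inj hxy)

end LieRing

/-! ### Lie rings with a rank and with uniform bounds -/

namespace Coordinates

open LieRing

variable {L : FirstOrder.Language.{u, v}} {M : Type w} [L.Structure M] {𝔤 : Type z} [LieRing 𝔤]

/-- A definable Lie ring with a rank on definable subgroups in which the finite indices of
centralisers in a definable subgroup are bounded. -/
structure IsTame (L : FirstOrder.Language.{u, v}) [L.Structure M] (c : Coordinates M 𝔤) : Prop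
    extends IsDefinableLieRing L c where
  exists_rank : ∃ δ : AddSubgroup 𝔤 → ℕ, ∀ H K : AddSubgroup 𝔤, c.IsDefinable L (H : Set 𝔤) →
    c.IsDefinable L (K : Set 𝔤) → H ≤ K → H.relIndex K = 0 → δ H < δ K
  exists_bound : ∀ K : AddSubgroup 𝔤, c.IsDefinable L (K : Set 𝔤) →
    ∃ k, ∀ x ∈ almostCentralizer K, (elementCentralizer x).relIndex K ≤ k

theorem IsDefinableLieRing.isTame {T : L.Theory} (D : TheoryDimension.{u, v, w} T) [Nonempty M]
    [M ⊨ T] {c : Coordinates M 𝔤} (hc : c.IsDefinableLieRing L) : c.IsTame L where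
  toIsDefinableLieRing := hc
  exists_rank := D.exists_rank hc.toIsDefinableAddGroup
  exists_bound _ hK := D.exists_relIndex_centralizer_le hc hK

variable {c : Coordinates M 𝔤}

theorem IsDefinableLieRing.isDefinable_elementCentralizer (hc : c.IsDefinableLieRing L) (a : 𝔤) :
    c.IsDefinable L (elementCentralizer a : Set 𝔤) :=
  have hA := hc.toIsDefinableAddGroup
  DefRel.isDefinable (R := fun x => ⁅a, x⁆ = 0) (hA.eq (hc.bracket (hA.const a) (hA.proj _)) (hA.const 0))

/-- With a bound `k` on the finite indices, finite index means that no `k + 1` elements of `K` are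
incongruent, a first-order condition. -/
theorem IsTame.isDefinable_almostCentralizer (hc : c.IsTame L) {K : AddSubgroup 𝔤}
    (hK : c.IsDefinable L (K : Set 𝔤)) : c.IsDefinable L (almostCentralizer K : Set 𝔤) := by
  obtain ⟨k, hk⟩ := hc.exists_bound K hK
  have hA := hc.toIsDefinableAddGroup
  have hcar := hc.carrier_definable
  have h : c.DefRel L fun v : Unit → 𝔤 => ¬ ∃ y : Fin (k + 1) → 𝔤, (∀ s, y s ∈ (K : Set 𝔤)) ∧
      ∀ p : {p : Fin (k + 1) × Fin (k + 1) // p.1 ≠ p.2}, ¬ ⁅v (), y p.1.1 - y p.1.2⁆ = 0 := by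
    refine DefRel.not hcar (DefRel.exists (R := fun v y => (∀ s, y s ∈ (K : Set 𝔤)) ∧
      ∀ p : {p : Fin (k + 1) × Fin (k + 1) // p.1 ≠ p.2}, ¬ ⁅v (), y p.1.1 - y p.1.2⁆ = 0) ?_)
    refine DefRel.and (DefRel.forall_finite hcar fun s => hK.mem hcar (hA.proj _))
      (DefRel.forall_finite hcar fun p => DefRel.not hcar (hA.eq
        (hc.bracket (hA.proj _) (hA.sub (hA.proj _) (hA.proj _))) (hA.const 0)))
  refine (congrArg (c.IsDefinable L) ?_).mp (DefRel.isDefinable (R := fun x =>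
    ¬ ∃ y : Fin (k + 1) → 𝔤, (∀ s, y s ∈ (K : Set 𝔤)) ∧
      ∀ p : {p : Fin (k + 1) × Fin (k + 1) // p.1 ≠ p.2}, ¬ ⁅x, y p.1.1 - y p.1.2⁆ = 0) h)
  ext x
  have h1 : (∃ y : Fin (k + 1) → 𝔤, (∀ s, y s ∈ (K : Set 𝔤)) ∧
      ∀ p : {p : Fin (k + 1) × Fin (k + 1) // p.1 ≠ p.2}, ¬ ⁅x, y p.1.1 - y p.1.2⁆ = 0) ↔
      (elementCentralizer x).HasIncongruent K (k + 1) := by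
    refine exists_congr fun y => and_congr_right fun _ => ?_
    exact ⟨fun h s t hst => h ⟨(s, t), hst⟩, fun h p => h _ _ p.2⟩
  rw [Set.mem_ofPred_eq, h1, AddSubgroup.hasIncongruent_iff, SetLike.mem_coe,
    mem_almostCentralizer]
  refine ⟨fun h h0 => h (Or.inl h0), ?_⟩
  rintro h (h0 | h0)
  · exact h h0
  · have := hk x h
    omega

/-- An infinite almost abelian ideal yields an infinite definable almost abelian ideal. -/
theorem IsTame.exists_definable_almost_abelian_ideal (hc : c.IsTame L) {J : LieIdeal ℤ 𝔤}
    (hJ : (⊥ : AddSubgroup 𝔤).relIndex J.toSubmodule.toAddSubgroup = 0)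
    (hJa : J.toSubmodule.toAddSubgroup ≤ almostCentralizer J.toSubmodule.toAddSubgroup) :
    ∃ B : LieIdeal ℤ 𝔤, c.IsDefinable L (B : Set 𝔤) ∧
      (⊥ : AddSubgroup 𝔤).relIndex B.toSubmodule.toAddSubgroup = 0 ∧
      B.toSubmodule.toAddSubgroup ≤ almostCentralizer B.toSubmodule.toAddSubgroup := by
  obtain ⟨δ, hδ⟩ := hc.exists_rank
  -- The last clause is invariance up to finite index, tested on every `D` that `J` almost
  -- centralises. This form survives the intersections below; it is applied to `D = C` once `C` is
  -- known to be such a `D`.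
  let P : AddSubgroup 𝔤 → Prop := fun C => c.IsDefinable L (C : Set 𝔤) ∧
    C.relIndex J.toSubmodule.toAddSubgroup ≠ 0 ∧
    ∀ D : AddSubgroup 𝔤, (∀ a ∈ J, (elementCentralizer a).relIndex D ≠ 0) →
      ∀ g, (C.comap (adHom g)).relIndex D ≠ 0
  have hPtop : P ⊤ := ⟨isDefinable_univ hc.carrier_definable, by simp, by simp⟩
  have hPinf : ∀ C, P C → ∀ a ∈ J, P (C ⊓ elementCentralizer a) := by
    rintro C ⟨h1, h2, h3⟩ a ha
    refine ⟨h1.inter (hc.isDefinable_elementCentralizer a),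
      AddSubgroup.relIndex_inf_ne_zero h2 (hJa ha), fun D hD g => ?_⟩
    have h4 := AddSubgroup.relIndex_inf_ne_zero (h3 D hD g)
      (AddSubgroup.relIndex_inf_ne_zero (hD a ha) (hD ⁅g, a⁆ (J.lie_mem ha)))
    refine fun h0 => h4 (AddSubgroup.relIndex_eq_zero_of_le_left ?_ h0)
    rintro y ⟨hy1, hy2, hy3⟩
    refine ⟨hy1, ?_⟩
    change ⁅a, y⁆ = 0 at hy2
    change ⁅⁅g, a⁆, y⁆ = 0 at hy3
    change ⁅a, ⁅g, y⁆⁆ = 0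
    rw [lie_lie, hy2, lie_zero, zero_sub, neg_eq_zero] at hy3
    exact hy3
  obtain ⟨⟨C, hC⟩, hmin⟩ : ∃ C : {C // P C}, ∀ C' : {C // P C}, δ C.1 ≤ δ C'.1 := by
    have : Nonempty {C // P C} := ⟨⟨⊤, hPtop⟩⟩
    exact ⟨Function.argmin (fun C : {C // P C} => δ C.1),
      fun C' => Function.argmin_le (fun C : {C // P C} => δ C.1) C'⟩
  -- If `C(a)` had infinite index in `C`, then `C ∩ C(a)` would have smaller rank.
  have hCJ : ∀ a ∈ J, (elementCentralizer a).relIndex C ≠ 0 := by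
    intro a ha h0
    have := hmin ⟨_, hPinf C hC a ha⟩
    refine absurd (hδ (C ⊓ elementCentralizer a) C (hPinf C hC a ha).1 hC.1 inf_le_left ?_)
      (not_lt.mpr this)
    rwa [inf_comm, AddSubgroup.inf_relIndex_right]
  let A : LieIdeal ℤ 𝔤 := almostCentralizerIdeal C (hC.2.2 C hCJ)
  have hA : c.IsDefinable L (A : Set 𝔤) := hc.isDefinable_almostCentralizer hC.1
  let B : LieIdeal ℤ 𝔤 := A ⊓ almostCentralizerIdeal A.toSubmodule.toAddSubgroup
    (relIndex_comap_adHom_ideal A)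
  have hB : B.toSubmodule.toAddSubgroup =
    A.toSubmodule.toAddSubgroup ⊓ almostCentralizer A.toSubmodule.toAddSubgroup := rfl
  obtain ⟨k, hk⟩ := hc.exists_bound C hC.1
  have hsymm : (almostCentralizer A.toSubmodule.toAddSubgroup).relIndex C ≠ 0 :=
    relIndex_almostCentralizer_ne_zero (k := k) le_rfl hk
  refine ⟨B, hA.inter (hc.isDefinable_almostCentralizer (K := A.toSubmodule.toAddSubgroup) hA),
    ?_, ?_⟩
  · have h1 : B.toSubmodule.toAddSubgroup.relIndex J.toSubmodule.toAddSubgroup ≠ 0 := by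
      rw [hB]
      refine AddSubgroup.relIndex_inf_ne_zero ?_
        (AddSubgroup.relIndex_ne_zero_trans hsymm hC.2.1)
      rw [AddSubgroup.relIndex_eq_one.mpr fun a ha => hCJ a ha]
      exact one_ne_zero
    by_contra h2
    exact AddSubgroup.relIndex_ne_zero_trans h2 h1 hJ
  · exact inf_le_right.trans (almostCentralizer_anti inf_le_left)

/-- A definable almost abelian ideal has a definable soluble ideal of finite index. -/
theorem IsTame.exists_definable_solvable_ideal (hc : c.IsTame L) {B : LieIdeal ℤ 𝔤}
    (hBd : c.IsDefinable L (B : Set 𝔤))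
    (hB : B.toSubmodule.toAddSubgroup ≤ almostCentralizer B.toSubmodule.toAddSubgroup) :
    ∃ S : LieIdeal ℤ 𝔤, c.IsDefinable L (S : Set 𝔤) ∧
      S.toSubmodule.toAddSubgroup.relIndex B.toSubmodule.toAddSubgroup ≠ 0 ∧
      LieAlgebra.derivedSeriesOfIdeal ℤ 𝔤 2 S = ⊥ := by
  obtain ⟨k, hk⟩ := hc.exists_bound B.toSubmodule.toAddSubgroup hBd
  have hfin : Finite (⁅B, B⁆ : LieIdeal ℤ 𝔤) := finite_lie_self hB fun x hx => hk x (hB hx)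
  let S : LieIdeal ℤ 𝔤 := B ⊓ LieModule.ker ℤ 𝔤 (⁅B, B⁆ : LieIdeal ℤ 𝔤)
  have hmem : ∀ x, x ∈ S ↔ x ∈ B ∧ ∀ f : (⁅B, B⁆ : LieIdeal ℤ 𝔤), ⁅(f : 𝔤), x⁆ = 0 := by
    intro x
    rw [LieSubmodule.mem_inf, LieModule.mem_ker]
    refine and_congr_right fun _ => forall_congr' fun f => ?_
    rw [Subtype.ext_iff, LieSubmodule.coe_bracket, ← lie_skew, LieSubmodule.coe_zero, neg_eq_zero]
  have hA := hc.toIsDefinableAddGroup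
  refine ⟨S, ?_, ?_, ?_⟩
  · refine (congrArg (c.IsDefinable L) ?_).mp (hBd.inter (DefRel.isDefinable
      (R := fun x => ∀ f : (⁅B, B⁆ : LieIdeal ℤ 𝔤), ⁅(f : 𝔤), x⁆ = 0)
      (DefRel.forall_finite hc.carrier_definable fun f =>
        hA.eq (hc.bracket (hA.const _) (hA.proj _)) (hA.const 0))))
    ext x
    exact (hmem x).symm
  · have h1 : (⨅ f : (⁅B, B⁆ : LieIdeal ℤ 𝔤), elementCentralizer (f : 𝔤)).relIndex
        B.toSubmodule.toAddSubgroup ≠ 0 :=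
      AddSubgroup.relIndex_iInf_ne_zero fun f => hB (LieSubmodule.lie_le_left B B f.2)
    rw [← AddSubgroup.inf_relIndex_right] at h1
    refine fun h0 => h1 (AddSubgroup.relIndex_eq_zero_of_le_left ?_ h0)
    intro x hx
    exact (hmem x).mpr ⟨hx.2, fun f => AddSubgroup.mem_iInf.mp hx.1 f⟩
  · simp only [LieAlgebra.derivedSeriesOfIdeal_succ, LieAlgebra.derivedSeriesOfIdeal_zero]
    rw [LieSubmodule.lie_eq_bot_iff]
    -- `S` centralises `[B,B]`, which contains `[S,S]`; so already `[S,[S,S]] = 0`.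
    intro x hx y hy
    have hx' : x ∈ S := LieSubmodule.lie_le_left S S hx
    have hy' : y ∈ (⁅B, B⁆ : LieIdeal ℤ 𝔤) := LieSubmodule.mono_lie inf_le_left inf_le_left hy
    rw [← lie_skew, ((hmem x).mp hx').2 ⟨y, hy'⟩, neg_zero]

end Coordinates

/-! ### Homomorphisms and ideals -/

namespace LieRing

variable {𝔤 : Type z} [LieRing 𝔤] {𝔥 : Type z'} [LieRing 𝔥]

/-- The underlying additive subgroup of an ideal. -/
abbrev idealAddSubgroup (I : LieIdeal ℤ 𝔤) : AddSubgroup 𝔤 := I.toSubmodule.toAddSubgroup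

/-- The underlying additive homomorphism of a homomorphism of Lie rings. -/
abbrev homAddMonoidHom (f : 𝔤 →ₗ⁅ℤ⁆ 𝔥) : 𝔤 →+ 𝔥 := (f : 𝔤 →ₗ[ℤ] 𝔥).toAddMonoidHom

/-- An additive homomorphism that respects brackets. -/
def homOfAddMonoidHom (f : 𝔤 →+ 𝔥) (hf : ∀ x y, f ⁅x, y⁆ = ⁅f x, f y⁆) : 𝔤 →ₗ⁅ℤ⁆ 𝔥 where
  toFun := f
  map_add' := map_add f
  map_smul' n x := map_zsmul f n x
  map_lie' := hf _ _

/-- The quotient homomorphism, for the standard structure of a Lie algebra over `ℤ`. -/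
def toQuotient (I : LieIdeal ℤ 𝔤) :
    @LieHom ℤ 𝔤 (𝔤 ⧸ I) _ _ LieRing.instLieAlgebra _ LieRing.instLieAlgebra :=
  homOfAddMonoidHom (Submodule.mkQ I.toSubmodule).toAddMonoidHom fun _ _ => rfl

theorem toQuotient_surjective (I : LieIdeal ℤ 𝔤) :
    Function.Surjective (toQuotient I) :=
  Submodule.mkQ_surjective _

theorem ker_toQuotient (I : LieIdeal ℤ 𝔤) : (toQuotient I).ker = I := by
  ext x
  exact LieSubmodule.Quotient.mk_eq_zero'

theorem isSolvable_ideal_iff {I : LieIdeal ℤ 𝔤} :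
    LieAlgebra.IsSolvable I ↔ ∃ k, LieAlgebra.derivedSeriesOfIdeal ℤ 𝔤 k I = ⊥ := by
  rw [LieAlgebra.isSolvable_iff ℤ]
  simp only [LieIdeal.derivedSeries_eq_bot_iff]

theorem derivedSeriesOfIdeal_comap_le (f : 𝔤 →ₗ⁅ℤ⁆ 𝔥) (I : LieIdeal ℤ 𝔥) (k : ℕ) :
    LieAlgebra.derivedSeriesOfIdeal ℤ 𝔤 k (I.comap f) ≤
      (LieAlgebra.derivedSeriesOfIdeal ℤ 𝔥 k I).comap f := by
  induction k with
  | zero => exact le_rfl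
  | succ k ih =>
    rw [LieAlgebra.derivedSeriesOfIdeal_succ, LieAlgebra.derivedSeriesOfIdeal_succ]
    exact (LieSubmodule.mono_lie ih ih).trans (LieIdeal.comap_bracket_le f)

theorem isSolvable_comap {f : 𝔤 →ₗ⁅ℤ⁆ 𝔥} (hf : LieAlgebra.IsSolvable f.ker) {I : LieIdeal ℤ 𝔥}
    (hI : LieAlgebra.IsSolvable I) : LieAlgebra.IsSolvable (I.comap f) := by
  rw [isSolvable_ideal_iff] at *
  obtain ⟨k, hk⟩ := hf
  obtain ⟨l, hl⟩ := hI
  refine ⟨k + l, ?_⟩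
  rw [LieAlgebra.derivedSeriesOfIdeal_add, ← le_bot_iff, ← hk]
  refine LieAlgebra.derivedSeriesOfIdeal_mono ?_ k
  have h := derivedSeriesOfIdeal_comap_le f I l
  rwa [hl] at h

theorem relIndex_ker_comap {f : 𝔤 →ₗ⁅ℤ⁆ 𝔥} (hf : Function.Surjective f) (K : AddSubgroup 𝔥) :
    (idealAddSubgroup f.ker).relIndex (K.comap (homAddMonoidHom f)) =
      (⊥ : AddSubgroup 𝔥).relIndex K := by
  have h : idealAddSubgroup f.ker = (⊥ : AddSubgroup 𝔥).comap (homAddMonoidHom f) := by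
    ext x
    exact LieHom.mem_ker
  rw [h, AddSubgroup.relIndex_comap, AddSubgroup.map_comap_eq_self_of_surjective hf]

theorem idealAddSubgroup_map {f : 𝔤 →ₗ⁅ℤ⁆ 𝔥} (hf : Function.Surjective f) (I : LieIdeal ℤ 𝔤) :
    idealAddSubgroup (I.map f) = (idealAddSubgroup I).map (homAddMonoidHom f) := by
  ext x
  have h := LieIdeal.coe_map_of_surjective (I := I) hf
  exact Iff.of_eq (congrArg (fun N : Submodule ℤ 𝔥 => x ∈ N) h)

theorem relIndex_ker_map {f : 𝔤 →ₗ⁅ℤ⁆ 𝔥} (hf : Function.Surjective f) (I : LieIdeal ℤ 𝔤) :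
    (idealAddSubgroup f.ker).relIndex (idealAddSubgroup I) =
      (⊥ : AddSubgroup 𝔥).relIndex (idealAddSubgroup (I.map f)) := by
  have h : idealAddSubgroup f.ker = (⊥ : AddSubgroup 𝔥).comap (homAddMonoidHom f) := by
    ext x
    exact LieHom.mem_ker
  rw [h, AddSubgroup.relIndex_comap, idealAddSubgroup_map hf]

/-- Finite ideals are contained in the almost centre. -/
theorem le_almostCentralizer_top_of_finite {I : LieIdeal ℤ 𝔤}
    (hI : (⊥ : AddSubgroup 𝔤).relIndex (idealAddSubgroup I) ≠ 0) :
    idealAddSubgroup I ≤ almostCentralizer ⊤ := by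
  intro x hx
  rw [mem_almostCentralizer, elementCentralizer_eq_comap, AddSubgroup.relIndex_comap]
  refine fun h0 => hI (AddSubgroup.relIndex_eq_zero_of_le_right ?_ h0)
  rintro _ ⟨y, -, rfl⟩
  exact lie_mem_left ℤ 𝔤 I x y hx

/-- Modulo a finite kernel, almost centralisers can be lifted. -/
theorem mem_almostCentralizer_comap {f : 𝔤 →ₗ⁅ℤ⁆ 𝔥}
    (hf : (⊥ : AddSubgroup 𝔤).relIndex (idealAddSubgroup f.ker) ≠ 0) {K : AddSubgroup 𝔥} {x : 𝔤}
    (hx : f x ∈ almostCentralizer K) : x ∈ almostCentralizer (K.comap (homAddMonoidHom f)) := by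
  refine AddSubgroup.relIndex_ne_zero_trans
    (K := (elementCentralizer (f x)).comap (homAddMonoidHom f)) ?_
    (AddSubgroup.relIndex_comap_ne_zero _ hx)
  rw [elementCentralizer_eq_comap x, AddSubgroup.relIndex_comap]
  -- On the preimage of `C(f x)` the map `[x, ·]` takes values in the finite kernel of `f`.
  refine fun h0 => hf (AddSubgroup.relIndex_eq_zero_of_le_right ?_ h0)
  rintro _ ⟨y, hy, rfl⟩
  change ⁅f x, f y⁆ = 0 at hy
  change ⁅x, y⁆ ∈ f.ker
  rw [LieHom.mem_ker, LieHom.map_lie, hy]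

theorem relIndex_comap_adHom_of_isAlmostAbelian {J J' : LieIdeal ℤ 𝔤}
    (h : IsAlmostAbelian (J ⧸ LieIdeal.comap J.incl J')) {x : 𝔤} (hx : x ∈ J) :
    ((idealAddSubgroup J').comap (adHom x)).relIndex (idealAddSubgroup J) ≠ 0 := by
  let q : J →+ J ⧸ LieIdeal.comap J.incl J' :=
    (Submodule.mkQ (LieIdeal.comap J.incl J').toSubmodule).toAddMonoidHom
  have h1 : q ⟨x, hx⟩ ∈ almostCenter (J ⧸ LieIdeal.comap J.incl J') := by
    rw [show almostCenter (J ⧸ LieIdeal.comap J.incl J') = ⊤ from h]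
    trivial
  have h2 : (elementCentralizer (q ⟨x, hx⟩)).index ≠ 0 :=
    AddSubgroup.FiniteIndex.index_ne_zero (self := h1)
  have h3 : ((elementCentralizer (q ⟨x, hx⟩)).comap q).index ≠ 0 := by
    rw [AddSubgroup.index_comap_of_surjective _ (Submodule.mkQ_surjective _)]
    exact h2
  have h4 : (elementCentralizer (q ⟨x, hx⟩)).comap q =
      ((idealAddSubgroup J').comap (adHom x)).addSubgroupOf (idealAddSubgroup J) := by
    ext y
    exact LieSubmodule.Quotient.mk_eq_zero' (N := LieIdeal.comap J.incl J')
      (m := ⁅(⟨x, hx⟩ : J), y⁆)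
  rw [h4] at h3
  exact h3

/-- An extension of an almost abelian ring by a finite one has almost abelian image. -/
theorem map_le_almostCentralizer {f : 𝔤 →ₗ⁅ℤ⁆ 𝔥} (hf : Function.Surjective f)
    {J J' : LieIdeal ℤ 𝔤} (h : IsAlmostAbelian (J ⧸ LieIdeal.comap J.incl J'))
    (hJ' : (idealAddSubgroup f.ker).relIndex (idealAddSubgroup J') ≠ 0) :
    idealAddSubgroup (J.map f) ≤ almostCentralizer (idealAddSubgroup (J.map f)) := by
  rw [idealAddSubgroup_map hf]
  rintro _ ⟨x, hx, rfl⟩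
  rw [mem_almostCentralizer, ← AddSubgroup.relIndex_comap]
  have h1 := relIndex_comap_adHom_of_isAlmostAbelian h hx
  rw [AddSubgroup.relIndex_comap] at h1
  -- `[x, J]` is finite modulo `J'`, and `J'` is finite modulo the kernel, so `[x, J]` is finite
  -- modulo the kernel.
  have h2 := AddSubgroup.relIndex_ne_zero_trans hJ' h1
  rw [← AddSubgroup.relIndex_comap] at h2
  refine fun h0 => h2 (AddSubgroup.relIndex_eq_zero_of_le_left ?_ h0)
  intro y hy
  change ⁅x, y⁆ ∈ f.ker at hy
  rw [LieHom.mem_ker, LieHom.map_lie] at hy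
  exact hy

theorem isAlmostAbelian_of_le {H : LieSubalgebra ℤ 𝔤}
    (hH : H.toSubmodule.toAddSubgroup ≤ almostCentralizer H.toSubmodule.toAddSubgroup) :
    IsAlmostAbelian H := by
  refine eq_top_iff.mpr fun x _ => ?_
  have h : elementCentralizer x =
      (elementCentralizer (x : 𝔤)).addSubgroupOf H.toSubmodule.toAddSubgroup := by
    ext y
    exact Subtype.ext_iff
  change (elementCentralizer x).FiniteIndex
  exact ⟨h ▸ hH x.2⟩

theorem isAlmostAbelian_of_lie_eq_zero (h : ∀ x y : 𝔤, ⁅x, y⁆ = 0) : IsAlmostAbelian 𝔤 := by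
  refine eq_top_iff.mpr fun x _ => ?_
  have h1 : elementCentralizer x = ⊤ := eq_top_iff.mpr fun y _ => h x y
  change (elementCentralizer x).FiniteIndex
  rw [h1]
  infer_instance

theorem hasIdealAlmostAbelianSeries_of_isSolvable {I : LieIdeal ℤ 𝔤}
    (hI : LieAlgebra.IsSolvable I) : HasIdealAlmostAbelianSeries I := by
  obtain ⟨n, hn⟩ := isSolvable_ideal_iff.mp hI
  refine ⟨n, fun k => LieAlgebra.derivedSeriesOfIdeal ℤ 𝔤 k I, rfl, hn, fun i _ =>
    ⟨LieAlgebra.derivedSeriesOfIdeal_succ_le I i, isAlmostAbelian_of_lie_eq_zero fun x y => ?_⟩⟩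
  obtain ⟨x, rfl⟩ := Submodule.Quotient.mk_surjective _ x
  obtain ⟨y, rfl⟩ := Submodule.Quotient.mk_surjective _ y
  refine (LieSubmodule.Quotient.mk_eq_zero' (m := ⁅x, y⁆)).mpr ?_
  change ⁅(x : 𝔤), (y : 𝔤)⁆ ∈ LieAlgebra.derivedSeriesOfIdeal ℤ 𝔤 (i + 1) I
  rw [LieAlgebra.derivedSeriesOfIdeal_succ]
  exact LieSubmodule.lie_mem_lie x.2 y.2

theorem radical_le_almostRadical : LieAlgebra.radical ℤ 𝔤 ≤ almostRadical 𝔤 :=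
  sSup_le_sSup fun _ hI => hasIdealAlmostAbelianSeries_of_isSolvable hI

/-- The radical is soluble if a soluble ideal has finite index in it. -/
theorem isSolvable_radical_of_relIndex_ne_zero {S : LieIdeal ℤ 𝔤} (hS : LieAlgebra.IsSolvable S)
    (h : (idealAddSubgroup S).relIndex (idealAddSubgroup (LieAlgebra.radical ℤ 𝔤)) ≠ 0) :
    LieAlgebra.IsSolvable (LieAlgebra.radical ℤ 𝔤) := by
  let R := LieAlgebra.radical ℤ 𝔤
  let P : LieIdeal ℤ 𝔤 → Prop := fun I => LieAlgebra.IsSolvable I ∧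
    (idealAddSubgroup I).relIndex (idealAddSubgroup R) ≠ 0
  have : Nonempty {I // P I} := ⟨⟨S, hS, h⟩⟩
  let I := Function.argmin fun I : {I // P I} =>
    (idealAddSubgroup I.1).relIndex (idealAddSubgroup R)
  have hmin := fun J => Function.argmin_le (fun I : {I // P I} =>
    (idealAddSubgroup I.1).relIndex (idealAddSubgroup R)) J
  -- `I` is a soluble ideal of least index in `R`. Adding a soluble ideal `J` keeps it soluble, so
  -- it cannot lower the index, and `J ≤ I`.
  have hle : R ≤ I.1 := by
    refine sSup_le fun J hJ => ?_
    have h1 : LieAlgebra.IsSolvable I.1 := I.2.1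
    have h2 : LieAlgebra.IsSolvable J := hJ
    have hIJ : LieAlgebra.IsSolvable (I.1 ⊔ J : LieIdeal ℤ 𝔤) := LieAlgebra.isSolvableAdd ℤ 𝔤
    have hIR : I.1 ⊔ J ≤ R := le_sSup hIJ
    have hmul := AddSubgroup.relIndex_mul_relIndex (idealAddSubgroup I.1)
      (idealAddSubgroup (I.1 ⊔ J)) (idealAddSubgroup R) (fun x hx => le_sup_left (a := I.1) hx)
      (fun x hx => hIR hx)
    have hne := I.2.2
    rw [← hmul] at hne
    have hmin' := hmin ⟨I.1 ⊔ J, hIJ, right_ne_zero_of_mul hne⟩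
    change (idealAddSubgroup I.1).relIndex (idealAddSubgroup R) ≤ _ at hmin'
    rw [← hmul] at hmin'
    have hone : (idealAddSubgroup I.1).relIndex (idealAddSubgroup (I.1 ⊔ J)) = 1 := by
      have h3 := Nat.pos_of_ne_zero (left_ne_zero_of_mul hne)
      have h4 := Nat.pos_of_ne_zero (right_ne_zero_of_mul hne)
      exact le_antisymm (Nat.le_of_mul_le_mul_right (by simpa using hmin') h4) h3
    rw [AddSubgroup.relIndex_eq_one] at hone
    exact fun x hx => hone (le_sup_right (a := I.1) hx)
  exact LieAlgebra.le_solvable_ideal_solvable hle I.2.1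

theorem isVirtuallySoluble_of_relIndex_ne_zero {S R : LieIdeal ℤ 𝔤}
    (hS : LieAlgebra.IsSolvable S) (h : (idealAddSubgroup S).relIndex (idealAddSubgroup R) ≠ 0) :
    IsVirtuallySoluble R := by
  let S' : LieSubalgebra ℤ R := (S.toLieSubalgebra).comap R.incl
  let f : S' →ₗ⁅ℤ⁆ S :=
    { toFun := fun x => ⟨x.1.1, x.2⟩
      map_add' := fun _ _ => rfl
      map_smul' := fun _ _ => rfl
      map_lie' := rfl }
  refine ⟨S', ⟨h⟩, Function.Injective.lieAlgebra_isSolvable (f := f) fun x y hxy => ?_⟩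
  exact Subtype.ext (Subtype.ext (Subtype.mk.inj hxy))

end LieRing

/-! ### Quotients by definable ideals -/

namespace Coordinates

open LieRing

variable {L : FirstOrder.Language.{u, v}} {M : Type w} [L.Structure M] {𝔤 : Type z} [LieRing 𝔤]
  {𝔥 : Type z'} [LieRing 𝔥] {c : Coordinates M 𝔤}

/-- The tuples stay the same; only equality is replaced by congruence modulo the definable kernel.
-/
theorem IsDefinableLieRing.push (hc : c.IsDefinableLieRing L) {f : 𝔤 →ₗ⁅ℤ⁆ 𝔥}
    (hf : Function.Surjective f) (hker : c.IsDefinable L (f.ker : Set 𝔤)) :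
    (c.push f hf).IsDefinableLieRing L := by
  have hA := hc.toIsDefinableAddGroup
  have hmem : ∀ x y, x - y ∈ (f.ker : Set 𝔤) ↔ f x = f y := fun x y => by
    rw [SetLike.mem_coe, LieHom.mem_ker, map_sub, sub_eq_zero]
  refine ⟨hc.carrier_definable, ?_, ?_, ?_⟩
  · refine DefRel.definableIn₂ (c := c) (R := fun x y => f x = f y) ?_
    exact (hker.mem hc.carrier_definable (hA.sub (hA.proj (Sum.inl ())) (hA.proj (Sum.inr ())))).congr
      fun v => hmem _ _
  · refine DefRel.definableIn₃ (c := c) (R := fun x y t => f x + f y = f t) ?_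
    refine (hker.mem hc.carrier_definable (hA.sub (hA.add (hA.proj (Sum.inl ()))
      (hA.proj (Sum.inr (Sum.inl ())))) (hA.proj (Sum.inr (Sum.inr ()))))).congr fun v => ?_
    rw [hmem, map_add]
  · refine DefRel.definableIn₃ (c := c) (R := fun x y t => ⁅f x, f y⁆ = f t) ?_
    refine (hker.mem hc.carrier_definable (hA.sub (hc.bracket (hA.proj (Sum.inl ()))
      (hA.proj (Sum.inr (Sum.inl ())))) (hA.proj (Sum.inr (Sum.inr ()))))).congr fun v => ?_
    rw [hmem, LieHom.map_lie]

theorem IsTame.isDefinable_almostCenter (hc : c.IsTame L) :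
    c.IsDefinable L (almostCenter 𝔤 : Set 𝔤) := by
  have h := hc.isDefinable_almostCentralizer (K := ⊤) (isDefinable_univ hc.carrier_definable)
  rw [almostCentralizer_top] at h
  exact h

theorem almostCenter_le_almostCentralizer (K : AddSubgroup 𝔤) :
    idealAddSubgroup (almostCenter 𝔤) ≤ almostCentralizer K := by
  rw [idealAddSubgroup, ← almostCentralizer_top]
  exact almostCentralizer_anti le_top

/-! ### Maximal definable soluble ideals and the almost radical -/

/-- There is a definable soluble ideal that is maximal up to finite index. -/
theorem IsTame.exists_maximal_solvable (hc : c.IsTame L) :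
    ∃ S : LieIdeal ℤ 𝔤, c.IsDefinable L (S : Set 𝔤) ∧ LieAlgebra.IsSolvable S ∧
      ∀ S' : LieIdeal ℤ 𝔤, c.IsDefinable L (S' : Set 𝔤) → LieAlgebra.IsSolvable S' → S ≤ S' →
        (idealAddSubgroup S).relIndex (idealAddSubgroup S') ≠ 0 := by
  obtain ⟨δ, hδ⟩ := hc.exists_rank
  let P : LieIdeal ℤ 𝔤 → Prop := fun S => c.IsDefinable L (S : Set 𝔤) ∧ LieAlgebra.IsSolvable S
  have hbot : P ⊥ := ⟨isDefinable_bot hc.toIsDefinableAddGroup, LieAlgebra.isSolvableBot ℤ 𝔤⟩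
  have : Nonempty {S // P S} := ⟨⟨⊥, hbot⟩⟩
  -- Minimising this defect maximises the rank. The subtraction is truncated, but `h2` below keeps
  -- it positive at the minimiser when the index is infinite.
  let f : {S // P S} → ℕ := fun S => δ ⊤ - δ (idealAddSubgroup S.1)
  refine ⟨(Function.argmin f).1, (Function.argmin f).2.1, (Function.argmin f).2.2,
    fun S' hS' hsol hle h0 => ?_⟩
  have h1 := hδ (idealAddSubgroup (Function.argmin f).1) (idealAddSubgroup S')
    (Function.argmin f).2.1 hS' hle h0
  have h2 := hδ (idealAddSubgroup (Function.argmin f).1) ⊤ (Function.argmin f).2.1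
    (isDefinable_univ hc.carrier_definable) le_top
    (AddSubgroup.relIndex_eq_zero_of_le_right le_top h0)
  have h3 : f (Function.argmin f) ≤ f ⟨S', hS', hsol⟩ := Function.argmin_le f _
  simp only [f] at h3 h2 h1
  omega

/-- Modulo a maximal definable soluble ideal, almost abelian ideals are finite. -/
theorem IsTame.finite_of_almost_abelian {f : 𝔤 →ₗ⁅ℤ⁆ 𝔥} (hf : Function.Surjective f)
    (hc : (c.push f hf).IsTame L) (hker : LieAlgebra.IsSolvable f.ker)
    (hmax : ∀ S' : LieIdeal ℤ 𝔤, c.IsDefinable L (S' : Set 𝔤) → LieAlgebra.IsSolvable S' →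
      f.ker ≤ S' → (idealAddSubgroup f.ker).relIndex (idealAddSubgroup S') ≠ 0)
    {J : LieIdeal ℤ 𝔥} (hJ : idealAddSubgroup J ≤ almostCentralizer (idealAddSubgroup J)) :
    (⊥ : AddSubgroup 𝔥).relIndex (idealAddSubgroup J) ≠ 0 := by
  intro h0
  obtain ⟨B, hBd, hB0, hB⟩ := hc.exists_definable_almost_abelian_ideal h0 hJ
  obtain ⟨S, hSd, hSB, hS⟩ := hc.exists_definable_solvable_ideal hBd hB
  have h1 := hmax (S.comap f) hSd (isSolvable_comap hker (isSolvable_ideal_iff.mpr ⟨2, hS⟩))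
    (fun x hx => by
      rw [LieHom.mem_ker] at hx
      rw [LieIdeal.mem_comap, hx]
      exact S.zero_mem)
  have h2 : (⊥ : AddSubgroup 𝔥).relIndex (idealAddSubgroup S) ≠ 0 := by
    rw [← relIndex_ker_comap hf]
    exact h1
  exact AddSubgroup.relIndex_ne_zero_trans h2 hSB hB0

/-- A maximal definable soluble ideal has finite index in the almost radical. -/
theorem relIndex_almostRadical_ne_zero {f : 𝔤 →ₗ⁅ℤ⁆ 𝔥} (hf : Function.Surjective f)
    (hfin : ∀ J : LieIdeal ℤ 𝔥, idealAddSubgroup J ≤ almostCentralizer (idealAddSubgroup J) →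
      (⊥ : AddSubgroup 𝔥).relIndex (idealAddSubgroup J) ≠ 0) :
    (idealAddSubgroup f.ker).relIndex (idealAddSubgroup (almostRadical 𝔤)) ≠ 0 := by
  have hle : almostRadical 𝔤 ≤ (almostCenter 𝔥).comap f := by
    refine sSup_le fun I hI => ?_
    obtain ⟨n, s, rfl, hn, hs⟩ := hI
    -- Induction from the bottom of the series: if the image of one term is finite, the image of the
    -- next larger one is almost abelian, hence finite by `hfin`.
    have key : ∀ k ≤ n, (idealAddSubgroup f.ker).relIndex (idealAddSubgroup (s (n - k))) ≠ 0 := by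
      intro k
      induction k with
      | zero =>
        intro _
        rw [Nat.sub_zero, hn, AddSubgroup.relIndex_eq_one.mpr]
        · exact one_ne_zero
        · intro x hx
          rw [show x = 0 from hx]
          exact (idealAddSubgroup f.ker).zero_mem
      | succ k ih =>
        intro hk
        have h1 := hs (n - (k + 1)) (by omega)
        rw [show n - (k + 1) + 1 = n - k by omega] at h1
        rw [relIndex_ker_map hf]
        exact hfin _ (map_le_almostCentralizer hf h1.2 (ih (by omega)))
    have h1 := key n le_rfl
    rw [Nat.sub_self, relIndex_ker_map hf] at h1
    have h2 := le_almostCentralizer_top_of_finite h1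
    rw [almostCentralizer_top] at h2
    rw [← LieIdeal.map_le_iff_le_comap]
    exact h2
  -- The almost centre of `𝔥` is itself almost abelian, so this one finite ideal bounds all the
  -- images at once.
  refine fun h0 => hfin (almostCenter 𝔥) (almostCenter_le_almostCentralizer _) ?_
  rw [← relIndex_ker_comap hf]
  exact AddSubgroup.relIndex_eq_zero_of_le_right (fun x hx => hle hx) h0

/-! ### Absolutely simple rings -/

theorem IsAbsolutelySimple.index_ne_zero (hs : c.IsAbsolutelySimple L)
    (hc : DefinableIn L c.carrier) {I : LieIdeal ℤ 𝔤} (hI : c.IsDefinable L (I : Set 𝔤))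
    (h : (⊥ : AddSubgroup 𝔤).relIndex (idealAddSubgroup I) = 0) :
    (idealAddSubgroup I).index ≠ 0 := by
  intro h0
  let J : LieIdeal ℤ (⊤ : LieSubalgebra ℤ 𝔤) := I.comap (⊤ : LieSubalgebra ℤ 𝔤).incl
  have himage : ((↑) '' (J : Set (⊤ : LieSubalgebra ℤ 𝔤)) : Set 𝔤) = I := by
    ext x
    constructor
    · rintro ⟨y, hy, rfl⟩
      exact hy
    · exact fun hx => ⟨⟨x, trivial⟩, hx, rfl⟩
  refine hs ⊤ (isDefinable_univ hc) ?_ ⟨J, ?_, ?_, ?_⟩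
  · change (⊤ : AddSubgroup 𝔤).FiniteIndex
    infer_instance
  · rw [himage]
    exact hI
  · intro hfin
    have h1 : (I : Set 𝔤).Finite := himage ▸ hfin.image _
    have h2 : Finite (idealAddSubgroup I) := h1
    rw [AddSubgroup.relIndex_bot_left] at h
    exact Nat.card_pos.ne' h
  · intro hfin
    refine hfin.index_ne_zero ?_
    have h1 := AddSubgroup.relIndex_eq_zero_of_le_right (H := idealAddSubgroup I) le_rfl
      ((AddSubgroup.relIndex_top_right _).trans h0)
    exact h1

theorem isVirtuallyAlmostAbelian_of_ideal {B : LieIdeal ℤ 𝔤} (hB : c.IsDefinable L (B : Set 𝔤))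
    (hfin : (idealAddSubgroup B).index ≠ 0)
    (h : idealAddSubgroup B ≤ almostCentralizer (idealAddSubgroup B)) :
    c.IsVirtuallyAlmostAbelian L :=
  ⟨B.toLieSubalgebra, hB, ⟨hfin⟩, isAlmostAbelian_of_le h⟩

/-- A counterexample in the image pulls back to one in `𝔤`: preimages are given by the same tuples,
stay infinite and keep their index. -/
theorem IsAbsolutelySimple.push (hs : c.IsAbsolutelySimple L) {f : 𝔤 →ₗ⁅ℤ⁆ 𝔥}
    (hf : Function.Surjective f) : (c.push f hf).IsAbsolutelySimple L := by
  rintro H hH hHfin ⟨I, hI, hIinf, hIfin⟩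
  let K : LieSubalgebra ℤ 𝔤 := H.comap f
  let g : K →ₗ⁅ℤ⁆ H :=
    { toFun := fun x => ⟨f x, x.2⟩
      map_add' := fun x y => Subtype.ext (map_add f x.1 y.1)
      map_smul' := fun n x => Subtype.ext (map_zsmul f n x.1)
      map_lie' := Subtype.ext (LieHom.map_lie f _ _) }
  have hg : Function.Surjective g := by
    rintro ⟨y, hy⟩
    obtain ⟨x, rfl⟩ := hf y
    exact ⟨⟨x, hy⟩, rfl⟩
  refine hs K hH ?_ ⟨I.comap g, ?_, ?_, ?_⟩
  · refine ⟨?_⟩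
    have h := AddSubgroup.index_comap_of_surjective H.toSubmodule.toAddSubgroup
      (f := homAddMonoidHom f) hf
    have h' : K.toSubmodule.toAddSubgroup.index = H.toSubmodule.toAddSubgroup.index := h
    rw [h']
    exact hHfin.index_ne_zero
  · have hI' : c.IsDefinable L (f ⁻¹' ((↑) '' (I : Set H))) := hI
    refine (congrArg (c.IsDefinable L) ?_).mp hI'
    ext x
    constructor
    · rintro ⟨y, hy, hyx⟩
      have hx : f x ∈ H := hyx ▸ y.2
      refine ⟨⟨x, hx⟩, ?_, rfl⟩
      rwa [show y = g ⟨x, hx⟩ from Subtype.ext hyx] at hy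
    · rintro ⟨y, hy, rfl⟩
      exact ⟨g y, hy, rfl⟩
  · intro hfin
    refine hIinf ((hfin.image g).subset fun y hy => ?_)
    obtain ⟨x, rfl⟩ := hg y
    exact ⟨x, hy, rfl⟩
  · intro hfin
    refine hIfin ⟨?_⟩
    rw [← AddSubgroup.index_comap_of_surjective _ (f := (g : K →ₗ[ℤ] H).toAddMonoidHom) hg]
    exact hfin.index_ne_zero

/-- An infinite almost centre would be a definable almost abelian ideal, of finite index by absolute
simplicity. -/
theorem IsTame.finite_almostCenter (hc : c.IsTame L) (hs : c.IsAbsolutelySimple L)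
    (hv : ¬ c.IsVirtuallyAlmostAbelian L) :
    (⊥ : AddSubgroup 𝔤).relIndex (idealAddSubgroup (almostCenter 𝔤)) ≠ 0 := fun h0 =>
  hv (isVirtuallyAlmostAbelian_of_ideal hc.isDefinable_almostCenter
    (hs.index_ne_zero hc.carrier_definable hc.isDefinable_almostCenter h0)
    (almostCenter_le_almostCentralizer _))

/-- An absolutely simple ring that is not virtually almost abelian is semi-simple modulo its almost
centre. -/
theorem IsTame.isSemiSimple (hc : c.IsTame L) (hs : c.IsAbsolutelySimple L)
    (hv : ¬ c.IsVirtuallyAlmostAbelian L) {f : 𝔤 →ₗ⁅ℤ⁆ 𝔥} (hf : Function.Surjective f)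
    (hker : f.ker = almostCenter 𝔤) (hc' : (c.push f hf).IsTame L) : IsSemiSimple 𝔥 := by
  have hfin : (⊥ : AddSubgroup 𝔤).relIndex (idealAddSubgroup f.ker) ≠ 0 := by
    rw [hker]
    exact hc.finite_almostCenter hs hv
  -- Since the kernel is finite, a preimage of an almost central element is almost central, hence in
  -- the kernel.
  have hcenter : almostCentralizer (⊤ : AddSubgroup 𝔥) = ⊥ := by
    refine eq_bot_iff.mpr fun y hy => ?_
    obtain ⟨x, rfl⟩ := hf y
    have hx := mem_almostCentralizer_comap (K := ⊤) hfin hy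
    rw [AddSubgroup.comap_top, almostCentralizer_top] at hx
    have hx' : x ∈ f.ker := by
      rw [hker]
      exact hx
    exact LieHom.mem_ker.mp hx'
  refine ⟨fun hab => ?_, fun I hI => ?_⟩
  · have htop : ∀ y : 𝔥, y = 0 := fun y => by
      have h1 : elementCentralizer y = ⊤ := eq_top_iff.mpr fun t _ => trivial_lie_zero 𝔥 𝔥 y t
      have h2 : y ∈ almostCentralizer (⊤ : AddSubgroup 𝔥) := by
        rw [mem_almostCentralizer, h1]
        simp
      rwa [hcenter] at h2
    have hZ : idealAddSubgroup (almostCenter 𝔤) = ⊤ := by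
      rw [← hker]
      exact eq_top_iff.mpr fun x _ => LieHom.mem_ker.mpr (htop (f x))
    exact hv (isVirtuallyAlmostAbelian_of_ideal hc.isDefinable_almostCenter (by simp [hZ])
      (almostCenter_le_almostCentralizer _))
  · by_cases h0 : (⊥ : AddSubgroup 𝔥).relIndex (idealAddSubgroup I) = 0
    · exfalso
      have hIa : idealAddSubgroup I ≤ almostCentralizer (idealAddSubgroup I) := by
        intro x hx
        rw [mem_almostCentralizer, AddSubgroup.relIndex_eq_one.mpr]
        · exact one_ne_zero
        · intro y hy
          exact congrArg Subtype.val (trivial_lie_zero I I ⟨x, hx⟩ ⟨y, hy⟩)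
      obtain ⟨B, hBd, hB0, hB⟩ := hc'.exists_definable_almost_abelian_ideal h0 hIa
      have hBi := (hs.push hf).index_ne_zero hc'.carrier_definable hBd hB0
      have hle : (idealAddSubgroup B).comap (homAddMonoidHom f) ≤
          almostCentralizer ((idealAddSubgroup B).comap (homAddMonoidHom f)) := fun x hx =>
        mem_almostCentralizer_comap hfin (hB (AddSubgroup.mem_comap.mp hx))
      refine hv (isVirtuallyAlmostAbelian_of_ideal (B := B.comap f) hBd ?_
        hle)
      have h := AddSubgroup.index_comap_of_surjective (idealAddSubgroup B)
        (f := homAddMonoidHom f) hf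
      have h' : (idealAddSubgroup (B.comap f)).index = (idealAddSubgroup B).index := h
      rw [h']
      exact hBi
    · have h1 := le_almostCentralizer_top_of_finite h0
      rw [hcenter] at h1
      exact eq_bot_iff.mpr h1

end Coordinates

/-! ### Proof of the theorem -/

open LieRing in
theorem mainTheorem8 {L : FirstOrder.Language.{u, v}} (T : L.Theory)
    (hT : IsFiniteDimensionalTheory.{u, v, max u v w} T)
    (M : Type (max u v w)) [L.Structure M] [Nonempty M] [M ⊨ T]
    (𝔤 : Type z) [LieRing 𝔤] (c : Coordinates M 𝔤) (hc : c.IsDefinableLieRing L) :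
    (c.IsDefinable L (LieAlgebra.radical ℤ 𝔤 : Set 𝔤) ∧
      LieAlgebra.IsSolvable (LieAlgebra.radical ℤ 𝔤)) ∧
    (LieAlgebra.radical ℤ 𝔤 ≤ LieRing.almostRadical 𝔤 ∧
      (LieAlgebra.radical ℤ 𝔤).toSubmodule.toAddSubgroup.IsFiniteRelIndex
        (LieRing.almostRadical 𝔤).toSubmodule.toAddSubgroup ∧
      c.IsDefinable L (LieRing.almostRadical 𝔤 : Set 𝔤) ∧
      LieRing.IsVirtuallySoluble (LieRing.almostRadical 𝔤)) ∧
    (c.IsAbsolutelySimple L → ¬ c.IsVirtuallyAlmostAbelian L →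
      (c.quotient (LieRing.almostCenter 𝔤)).IsDefinableLieRing L ∧
      (c.quotient (LieRing.almostCenter 𝔤)).IsAbsolutelySimple L ∧
      LieRing.IsSemiSimple (𝔤 ⧸ LieRing.almostCenter 𝔤)) := by
  obtain ⟨D⟩ := hT
  have htame := hc.isTame D
  obtain ⟨S, hSd, hS, hmax⟩ := htame.exists_maximal_solvable
  have hSR : S ≤ LieAlgebra.radical ℤ 𝔤 := le_sSup hS
  have hRA : LieAlgebra.radical ℤ 𝔤 ≤ almostRadical 𝔤 := radical_le_almostRadical
  have hSA : (idealAddSubgroup S).relIndex (idealAddSubgroup (almostRadical 𝔤)) ≠ 0 := by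
    -- The quotient map is generalised to a surjection `f`, so that `S` can be replaced by `f.ker`.
    obtain ⟨f, hf, hfker⟩ : ∃ f : @LieHom ℤ 𝔤 (𝔤 ⧸ S) _ _ LieRing.instLieAlgebra _
        LieRing.instLieAlgebra, Function.Surjective f ∧ f.ker = S :=
      ⟨toQuotient S, toQuotient_surjective S, ker_toQuotient S⟩
    rw [← hfker] at hSd hS hmax ⊢
    have hc' := (hc.push hf hSd).isTame D
    exact Coordinates.relIndex_almostRadical_ne_zero hf fun J hJ =>
      hc'.finite_of_almost_abelian hf hS hmax hJ
  have hSR' : (idealAddSubgroup S).relIndex (idealAddSubgroup (LieAlgebra.radical ℤ 𝔤)) ≠ 0 :=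
    fun h0 => hSA (AddSubgroup.relIndex_eq_zero_of_le_right (fun x hx => hRA hx) h0)
  have hA := hc.toIsDefinableAddGroup
  refine ⟨⟨?_, isSolvable_radical_of_relIndex_ne_zero hS hSR'⟩, ⟨hRA, ⟨?_⟩, ?_,
    isVirtuallySoluble_of_relIndex_ne_zero hS hSA⟩, fun hs hv => ?_⟩
  · exact Coordinates.IsDefinable.of_relIndex_ne_zero hA (H := idealAddSubgroup S)
      (K := idealAddSubgroup (LieAlgebra.radical ℤ 𝔤)) hSd hSR hSR'
  · exact fun h0 => hSA (AddSubgroup.relIndex_eq_zero_of_le_left hSR h0)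
  · exact Coordinates.IsDefinable.of_relIndex_ne_zero hA (H := idealAddSubgroup S)
      (K := idealAddSubgroup (almostRadical 𝔤)) hSd (hSR.trans hRA) hSA
  · have hf := toQuotient_surjective (almostCenter 𝔤)
    have hker := ker_toQuotient (almostCenter 𝔤)
    have hd : (c.quotient (almostCenter 𝔤)).IsDefinableLieRing L :=
      hc.push hf (by rw [hker]; exact htame.isDefinable_almostCenter)
    exact ⟨hd, hs.push hf, htame.isSemiSimple hs hv hf hker (hd.isTame D)⟩
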